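/- Let $n\ge 0$ and $L\ge 1$ be integers. **The numbers $a_{n,L}$.** A Motzkin path of length $n$ is a lattice path in $\mathbb Z^2$ from $(0,0)$ to $(n,0)$ with steps $(1,1)$, $(1,0)$, $(1,-1)$ that never goes below the $x$-axis. Let $M_{n,h}$ be the number of Motzkin paths of length $n$ that do not go above the line $y=h$, and let $M'_{n,h}$ be the number of those that in addition have no step $(1,0)$ on the line $y=h$. Put $a_{n,L}=M_{n,h}$ if $L=2h+1$ and $a_{n,L}=M'_{n,h}$ if $L=2h$. **Walks in simplices.** For $d,m\ge1$ let $\Delta_{d,m}=\{x\in\mathbb Z_{\ge0}^d: x_1+\dots+x_d=m\}$, let $e_1,\dots,e_d$ be the standard basis vectors, $e_{d+1}=e_1$, and $s_i=e_{i+1}-e_i$ for $1\le i\le d$. Let $D_{d,m}$ be the directed graph with vertex set $\Delta_{d,m}$ and an edge $(x,y)$ whenever $y-x=s_i$ for some $i\in\{1,\dots,d\}$. The corners of $\Delta_{d,m}$ are the points $m e_k$, $1\le k\le d$. **Standard cylindric tableaux.** A cylindric shape of period $(d,L)$ is a weakly decreasing sequence of integers $\lambda=(\lambda_i)_{i\in\mathbb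 Z}$ with $\lambda_i=\lambda_{i+d}+L$ for all $i$; it is determined by $[\lambda_1,\dots,\lambda_d]$. Its Young diagram $Y_\lambda$ is the set of classes $\langle i,j\rangle$ in $\mathbb Z^2/(-d,L)\mathbb Z$ with $j\le\lambda_i$. If $Y_\mu\subseteq Y_\lambda$, a standard cylindric tableau of period $(d,L)$ with $n$ cells, inner shape $\mu$ and outer shape $\lambda$ is a bijection $T:Y_\lambda\setminus Y_\mu\to\{1,\dots,n\}$ such that $T(\langle i,j\rangle)<T(\langle i+1,j\rangle)$ and $T(\langle i,j\rangle)<T(\langle i,j+1\rangle)$ whenever both cells lie in $Y_\lambda\setminus Y_\mu$. **Exclusion processes.** Let $E_{d,L}$ be the directed graph whose vertices (states) are the words $u=u_1\cdots u_N\in\{0,1\}^N$, $N=d+L$, with exactly $d$ ones, indices being read modulo $N$, with an edge from $u$ to $v$ whenever there is an $r$ with $u_{r-1}u_r=01$, $v_{r-1}v_r=10$ and $u_t=v_t$ for all other $t$. A necklace $\langle u\rangle$ is the class of a state $u$ under cyclic rotation. Let $N_{d,L}$ be the directed multigraph on the necklaces in which the number of edges from $\langle u\rangle$ to $\langle v\rangle$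 is the number of states $\tilde v\in\langle v\rangle$ such that $E_{d,L}$ has an edge from $u$ to $\tilde v$ (this does not depend on the representative $u$). **Claim.** Each of the following sets has cardinality $a_{n,L}$: - (a) the set of standard cylindric tableaux of period $(3,L)$ with $n$ cells and inner shape $[0,0,0]$ (and arbitrary outer shape); - (b) the set of $n$-step walks in $D_{3,L}$ starting at any given corner of $\Delta_{3,L}$; - (b$'$) the set of $n$-step walks in $D_{L,3}$ starting at any given corner of $\Delta_{L,3}$; - (c) the set of $n$-step walks in $E_{3,L}$ starting at the state $1^3 0^L$; - (d) the set of $n$-step walks in $N_{3,L}$ starting at the necklace $\langle 1^3 0^L\rangle$. -/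

import Mathlib

/-! ### Walks in directed multigraphs

A directed multigraph is a quiver: `a ⟶ b` is the type of edges from `a` to `b`. -/

/-- The `n`-step walks in a directed multigraph that start at the vertex `u`. -/
def WalksFrom {V : Type} [Quiver.{0} V] (n : ℕ) (u : V) : Type :=
  {p : Quiver.PathStar u // p.2.length = n}

/-! ### Motzkin paths and the numbers `a_{n,L}` -/

/-- A Motzkin path of length `n`, given by the sequence of its `n + 1` lattice points. -/
structure MotzkinPath (n : ℕ) where
  point : Fin (n + 1) → ℤ × ℤ
  start : point 0 = (0, 0)
  finish : point (Fin.last n) = ((n : ℤ), 0)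
  step : ∀ k : Fin n, point k.succ - point k.castSucc ∈ ({(1, 1), (1, 0), (1, -1)} : Set (ℤ × ℤ))
  nonneg : ∀ k, 0 ≤ (point k).2

/-- `M_{n,h}`: the number of Motzkin paths of length `n` and height at most `h`. -/
noncomputable def motzkinCount (n h : ℕ) : ℕ :=
  Nat.card {p : MotzkinPath n // ∀ k, (p.point k).2 ≤ h}

/-- `M'_{n,h}`: the number of Motzkin paths of length `n` and height at most `h` that have no
step `(1,0)` on the line `y = h`. -/
noncomputable def motzkinCount' (n h : ℕ) : ℕ :=
  Nat.card {p : MotzkinPath n // (∀ k, (p.point k).2 ≤ h) ∧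
    ∀ k : Fin n, ¬ ((p.point k.castSucc).2 = h ∧ (p.point k.succ).2 = h)}

/-- `a_{n,L}`, equal to `M'_{n,h}` if `L = 2h` and to `M_{n,h}` if `L = 2h + 1`. -/
noncomputable def boundedMotzkin (n L : ℕ) : ℕ :=
  if Even L then motzkinCount' n (L / 2) else motzkinCount n (L / 2)

/-! ### Simplices -/

/-- `Δ_{d,L}`: the points of `ℕ^d` whose coordinates add up to `L`. -/
def Simplex (d L : ℕ) : Type := {x : Fin d → ℕ // ∑ i, x i = L}

/-- The step `s_i = e_{i+1} - e_i`, with indices taken cyclically. -/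
def simplexStep {d : ℕ} (i : Fin d) : Fin d → ℤ :=
  Pi.single (finRotate d i) 1 - Pi.single i 1

/-- The directed graph on `Δ_{d,L}` with an edge `(x, y)` whenever `y - x` is one of the steps
`s_i`. -/
instance Simplex.instQuiver (d L : ℕ) : Quiver.{0} (Simplex d L) where
  Hom x y := PLift (∃ i : Fin d, (fun j => (y.1 j : ℤ) - (x.1 j : ℤ)) = simplexStep i)

/-- The corner of `Δ_{d,L}` whose `k`-th coordinate is `L` and whose other coordinates are `0`. -/
def Simplex.corner (d L : ℕ) (k : Fin d) : Simplex d L :=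
  ⟨Pi.single k L, by simp⟩

/-! ### Cylindric shapes and standard cylindric tableaux -/

/-- The cylinder `ℤ² / (-d, L)ℤ`. -/
def Cylinder (d L : ℕ) : Type :=
  (ℤ × ℤ) ⧸ AddSubgroup.zmultiples ((-(d : ℤ), (L : ℤ)) : ℤ × ℤ)

/-- The cell `⟨i, j⟩` in row `i` (counted downwards) and column `j` (counted rightwards). -/
def Cylinder.cell (d L : ℕ) (i j : ℤ) : Cylinder d L :=
  QuotientAddGroup.mk (i, j)

/-- A cylindric shape of period `(d, L)`. -/
@[ext]
structure CylindricShape (d L : ℕ) where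
  row : ℤ → ℤ
  antitone_row : Antitone row
  periodic : ∀ i, row i = row (i + d) + L

/-- The Young diagram of a cylindric shape. -/
def CylindricShape.young {d L : ℕ} (lam : CylindricShape d L) : Set (Cylinder d L) :=
  {c | ∃ i j : ℤ, c = Cylinder.cell d L i j ∧ j ≤ lam.row i}

theorem CylindricShape.cell_mem_young {d L : ℕ} (lam : CylindricShape d L) (i j : ℤ) :
    Cylinder.cell d L i j ∈ lam.young ↔ j ≤ lam.row i := by
  have key : ∀ (k : ℤ) (i : ℤ), lam.row (i + k * d) = lam.row i - k * L := by
    intro k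
    induction k using Int.induction_on with
    | zero => intro i; simp
    | succ m ih =>
      intro i
      have h1 := lam.periodic (i + m * d)
      have h2 := ih i
      have h3 : i + ((m : ℤ) + 1) * d = i + m * d + d := by ring
      rw [h3]; linarith
    | pred m ih =>
      intro i
      have h1 := lam.periodic (i + (-(m : ℤ) - 1) * d)
      have h2 := ih i
      have h3 : i + (-(m : ℤ) - 1) * d + d = i + -(m : ℤ) * d := by ring
      rw [h3] at h1; linarith
  constructor
  · rintro ⟨i', j', h, hj⟩
    obtain ⟨k, hk⟩ := AddSubgroup.mem_zmultiples_iff.1 (QuotientAddGroup.eq.1 h)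
    simp only [Prod.smul_mk, smul_eq_mul, Prod.ext_iff, Prod.fst_add, Prod.snd_add, Prod.fst_neg,
      Prod.snd_neg] at hk
    have := key (-k) i
    have h1 : i' = i + -k * d := by linarith [hk.1]
    rw [h1] at hj
    linarith [hk.2]
  · intro h
    exact ⟨i, j, rfl, h⟩

/-- The shape `[0, …, 0]` of period `(d, L)`, with `λ_1 = … = λ_d = 0`. -/
def CylindricShape.zero (d L : ℕ) [NeZero d] : CylindricShape d L where
  row i := -(L * ((i - 1) / (d : ℤ)))
  antitone_row := by
    intro i j h
    have hd : (0 : ℤ) ≤ d := by positivity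
    have : (i - 1) / (d : ℤ) ≤ (j - 1) / (d : ℤ) := Int.ediv_le_ediv (by
      exact_mod_cast Nat.pos_of_ne_zero (NeZero.ne d)) (by linarith)
    have hL : (0 : ℤ) ≤ L := by positivity
    simp only [neg_le_neg_iff]
    exact mul_le_mul_of_nonneg_left this hL
  periodic := by
    intro i
    have hd : (d : ℤ) ≠ 0 := by exact_mod_cast NeZero.ne d
    have : (i + d - 1) / (d : ℤ) = (i - 1) / (d : ℤ) + 1 := by
      rw [show i + (d : ℤ) - 1 = i - 1 + d by ring]
      exact Int.add_ediv_of_dvd_right (dvd_refl _) |>.trans (by rw [Int.ediv_self hd])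
    rw [this]; ring

theorem CylindricShape.zero_row (d L : ℕ) [NeZero d] (i : ℤ) (h1 : 1 ≤ i) (hd : i ≤ d) :
    (CylindricShape.zero d L).row i = 0 := by
  have : (i - 1) / (d : ℤ) = 0 := Int.ediv_eq_zero_of_lt (by linarith) (by linarith)
  simp [CylindricShape.zero, this]

/-- The cylindric Young diagram of shape `λ/μ`. -/
def skewYoung {d L : ℕ} (lam mu : CylindricShape d L) : Set (Cylinder d L) :=
  lam.young \ mu.young

/-- A standard cylindric tableau of shape `λ/μ` with `n` cells. -/
structure StandardCylindricTableau {d L : ℕ} (n : ℕ) (lam mu : CylindricShape d L) where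
  contained : mu.young ⊆ lam.young
  entry : skewYoung lam mu ≃ Set.Icc 1 n
  column_lt : ∀ (i j : ℤ) (h : Cylinder.cell d L i j ∈ skewYoung lam mu)
    (h' : Cylinder.cell d L (i + 1) j ∈ skewYoung lam mu),
    (entry ⟨_, h⟩ : ℕ) < entry ⟨_, h'⟩
  row_lt : ∀ (i j : ℤ) (h : Cylinder.cell d L i j ∈ skewYoung lam mu)
    (h' : Cylinder.cell d L i (j + 1) ∈ skewYoung lam mu),
    (entry ⟨_, h⟩ : ℕ) < entry ⟨_, h'⟩

/-- The standard cylindric tableaux with `n` cells and inner shape `μ` (and any outer shape). -/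
def TableauxFrom {d L : ℕ} (n : ℕ) (mu : CylindricShape d L) : Type :=
  Σ lam : CylindricShape d L, StandardCylindricTableau n lam mu

/-! ### The exclusion process on a cycle -/

/-- The states of the exclusion process on the cycle `ℤ/(d+L)` with `d` particles; `u r = true`
means that the site `r` contains a particle. -/
def ExclusionState (d L : ℕ) : Type :=
  {u : ZMod (d + L) → Bool // {r | u r = true}.ncard = d}

/-- A particle jumps from a site `r` to the empty site `r - 1`: `u_{r-1} u_r = 01`,
`v_{r-1} v_r = 10`, and nothing else changes. -/
def ExclusionState.Jump {d L : ℕ} (u v : ExclusionState d L) : Prop :=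
  ∃ r : ZMod (d + L), u.1 (r - 1) = false ∧ u.1 r = true ∧ v.1 (r - 1) = true ∧ v.1 r = false ∧
    ∀ t, t ≠ r - 1 → t ≠ r → u.1 t = v.1 t

/-- The directed graph of states, whose edges are the valid jumps. -/
instance ExclusionState.instQuiver (d L : ℕ) : Quiver.{0} (ExclusionState d L) where
  Hom u v := PLift (u.Jump v)

/-- The state `1^d 0^L`, in which exactly the sites `1, …, d` are occupied. -/
def ExclusionState.packed (d L : ℕ) : ExclusionState d L :=
  ⟨fun r => decide (r ∈ (Finset.Icc 1 d).image (Nat.cast : ℕ → ZMod (d + L))), by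
    have h : {r : ZMod (d + L) | decide (r ∈ (Finset.Icc 1 d).image (Nat.cast : ℕ → ZMod (d + L))) = true} =
        (fun k : ℕ => (k : ZMod (d + L))) '' (Finset.Icc 1 d : Finset ℕ) := by
      ext r; simp
    rw [h, Set.InjOn.ncard_image]
    · rw [Set.ncard_coe_finset]; simp
    · intro a ha b hb hab
      simp only [Finset.coe_Icc, Set.mem_Icc] at ha hb
      have hmod := (ZMod.natCast_eq_natCast_iff _ _ _).1 hab
      rcases le_total a b with hle | hle
      · have := (Nat.modEq_iff_dvd' hle).1 hmod
        by_contra hne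
        have := Nat.le_of_dvd (by omega) this
        omega
      · have := (Nat.modEq_iff_dvd' hle).1 hmod.symm
        by_contra hne
        have := Nat.le_of_dvd (by omega) this
        omega⟩

/-- Two states are equivalent if they differ by a cyclic rotation. -/
def ExclusionState.rotationSetoid (d L : ℕ) : Setoid (ExclusionState d L) where
  r u v := ∃ t : ZMod (d + L), ∀ r, u.1 r = v.1 (r + t)
  iseqv :=
    { refl := fun u => ⟨0, fun r => by rw [add_zero]⟩
      symm := fun ⟨t, h⟩ => ⟨-t, fun r => by rw [h, neg_add_cancel_right]⟩
      trans := fun ⟨t, h⟩ ⟨s, h'⟩ => ⟨t + s, fun r => by rw [h, h', add_assoc]⟩ }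

/-- Necklaces: states up to cyclic rotation. -/
def Necklace (d L : ℕ) : Type := Quotient (ExclusionState.rotationSetoid d L)

/-- The necklace of a state. -/
def ExclusionState.necklace {d L : ℕ} (u : ExclusionState d L) : Necklace d L :=
  Quotient.mk (ExclusionState.rotationSetoid d L) u

/-- The states in the necklace `b` that can be reached from the state `u` by one jump. -/
def ExclusionState.JumpsInto {d L : ℕ} (u : ExclusionState d L) (b : Necklace d L) : Type :=
  {v : ExclusionState d L // v.necklace = b ∧ u.Jump v}

/-- The directed multigraph of necklaces: the edges from `a` to `b` correspond to the states in `b`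
that can be reached by one jump from a representative of `a`. By `jumpsInto_equiv` below, the number
of edges does not depend on the representative. -/
noncomputable instance Necklace.instQuiver (d L : ℕ) : Quiver.{0} (Necklace d L) where
  Hom a b := ExclusionState.JumpsInto (Quotient.out a) b

/-- Rotation of a state. -/
def ExclusionState.rotate {d L : ℕ} (t : ZMod (d + L)) (u : ExclusionState d L) :
    ExclusionState d L :=
  ⟨fun r => u.1 (r + t), by
    refine Eq.trans ?_ u.2
    exact Set.ncard_congr (fun r _ => r + t) (fun r h => h)
      (fun a b _ _ h => add_right_cancel h)
      (fun b hb => ⟨b - t, by simpa using hb, by simp⟩)⟩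

theorem ExclusionState.jumpsInto_equiv {d L : ℕ} {u u' : ExclusionState d L}
    (h : u.necklace = u'.necklace) (b : Necklace d L) :
    Nonempty (u.JumpsInto b ≃ u'.JumpsInto b) := by
  have neck : ∀ (t : ZMod (d + L)) (v : ExclusionState d L), (v.rotate t).necklace = v.necklace :=
    fun t v => Quotient.sound ⟨t, fun r => rfl⟩
  have jump : ∀ (t : ZMod (d + L)) (v w : ExclusionState d L), v.Jump w →
      (v.rotate t).Jump (w.rotate t) := by
    rintro t v w ⟨r, h1, h2, h3, h4, h5⟩
    have e : r - t - 1 + t = r - 1 := by ring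
    refine ⟨r - t, ?_, ?_, ?_, ?_, ?_⟩
    · simpa [rotate, e] using h1
    · simpa [rotate] using h2
    · simpa [rotate, e] using h3
    · simpa [rotate] using h4
    · intro s hs hs'
      refine h5 _ (fun hh => hs ?_) (fun hh => hs' ?_)
      · rw [← e] at hh; exact add_right_cancel hh
      · exact eq_sub_of_add_eq hh
  obtain ⟨t, ht⟩ := Quotient.exact h
  have hu : u'.rotate t = u := Subtype.ext (funext fun r => (ht r).symm)
  have hu' : u.rotate (-t) = u' := by
    rw [← hu]; exact Subtype.ext (funext fun r => by simp [rotate])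
  refine ⟨⟨fun v => ⟨v.1.rotate (-t), (neck _ _).trans v.2.1, ?_⟩,
    fun v => ⟨v.1.rotate t, (neck _ _).trans v.2.1, ?_⟩, ?_, ?_⟩⟩
  · have := jump (-t) _ _ v.2.2
    rwa [hu'] at this
  · have := jump t _ _ v.2.2
    rwa [hu] at this
  · intro v
    exact Subtype.ext (Subtype.ext (funext fun r => by simp [rotate]))
  · intro v
    exact Subtype.ext (Subtype.ext (funext fun r => by simp [rotate]))

/-! ### Walks and their first step -/

/-! All the sets are growth histories of one object: starting from the shape `[0,0,0]` of period
`(3, L)`, add `n` cells one at a time. A tableau records the order of the cells. The differences of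
consecutive rows walk in the triangle. The ends of the three rows, read modulo `L`, move on a cycle,
and their multiplicities walk in `D_{L,3}`. The numbers `k - row k`, read modulo `3 + L`, are the
positions of the particles. In each model the possible moves correspond to the rows that can be
extended, so `growthCount` counts them all (`finite_and_card_eq_growthCount`,
`card_walksFrom_eq_growthCount`). Walks on necklaces lift uniquely to walks on states.

Motzkin paths become sequences of heights with steps from `x` to `y` subject to `x + y < L`. This
one inequality encodes both the height bound and, for even `L`, the ban on level steps at the top.

The two sides meet in `growthCount_eq_sum`: from any point `(a, b, c)` of the triangle, the number
of walks is the sum over heights `j` of `weight j a b c` times the number of height sequences from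
`j` to `0`. The induction works because `weight` intertwines the two step operators: summing it over
the three neighbours of a point equals summing it over the admissible neighbours of `j`
(`weight_neighbours`, `weight_neighbours_top`), and it vanishes one step outside either domain
(`weight_eq_zero`). At a corner only `j = 0` has nonzero weight, which leaves the Motzkin number. -/

theorem Quiver.Path.toPath_comp_injective {V : Type} [Quiver.{0} V] {u v a a' : V}
    {e : u ⟶ a} {e' : u ⟶ a'} {p : Quiver.Path a v} {p' : Quiver.Path a' v}
    (h : e.toPath.comp p = e'.toPath.comp p') :
    (⟨⟨a, e⟩, p⟩ : Σ s : Quiver.Star u, Quiver.Path s.1 v) = ⟨⟨a', e'⟩, p'⟩ := by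
  induction p with
  | nil =>
    have hl := congrArg Quiver.Path.length h
    simp only [Quiver.Path.length_comp, Quiver.Path.length_toPath, Quiver.Path.length_nil] at hl
    cases p' with
    | nil =>
      obtain rfl := Quiver.Path.hom_heq_of_cons_eq_cons h |> eq_of_heq
      rfl
    | cons q f => simp at hl
  | cons q f ih =>
    cases p' with
    | nil =>
      have hl := congrArg Quiver.Path.length h
      simp at hl
    | cons q' f' =>
      simp only [Quiver.Path.comp_cons] at h
      obtain rfl := Quiver.Path.obj_eq_of_cons_eq_cons h
      cases ih (eq_of_heq (Quiver.Path.heq_of_cons_eq_cons h))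
      cases Quiver.Path.hom_heq_of_cons_eq_cons h
      rfl

/-- Prepending a step to a walk. -/
def WalksFrom.cons {V : Type} [Quiver.{0} V] {n : ℕ} {u : V}
    (w : Σ s : Quiver.Star u, WalksFrom n s.1) : WalksFrom (n + 1) u :=
  ⟨⟨w.2.1.1, w.1.2.toPath.comp w.2.1.2⟩, by
    simp [w.2.2, add_comm]⟩

/-- Paths are built by appending edges at the end, so the unique splitting into a first edge and a
remaining walk has to be proved. -/
theorem WalksFrom.cons_bijective {V : Type} [Quiver.{0} V] (n : ℕ) (u : V) :
    Function.Bijective (WalksFrom.cons (n := n) (u := u)) := by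
  constructor
  · rintro ⟨⟨a, e⟩, ⟨⟨v, p⟩, hp⟩⟩ ⟨⟨a', e'⟩, ⟨⟨v', p'⟩, hp'⟩⟩ h
    have h := congrArg Subtype.val h
    simp only [WalksFrom.cons] at h
    injection h with h1 h2
    subst h1
    have := Quiver.Path.toPath_comp_injective (eq_of_heq h2)
    cases this
    rfl
  · rintro ⟨⟨v, p⟩, hp⟩
    obtain ⟨a, e, q, hq, rfl⟩ := p.eq_toPath_comp_of_length_eq_succ hp
    exact ⟨⟨⟨a, e⟩, ⟨⟨v, q⟩, hq⟩⟩, rfl⟩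

/-- A walk of length `n + 1` is a step followed by a walk of length `n`. -/
noncomputable def WalksFrom.succEquiv {V : Type} [Quiver.{0} V] (n : ℕ) (u : V) :
    WalksFrom (n + 1) u ≃ Σ s : Quiver.Star u, WalksFrom n s.1 :=
  (Equiv.ofBijective _ (WalksFrom.cons_bijective n u)).symm

theorem WalksFrom.zero_nonempty_equiv {V : Type} [Quiver.{0} V] (u : V) :
    Nonempty (WalksFrom 0 u ≃ Unit) := by
  refine ⟨⟨fun _ => (), fun _ => ⟨⟨u, .nil⟩, rfl⟩, ?_, fun _ => rfl⟩⟩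
  rintro ⟨⟨v, p⟩, hp⟩
  cases p with
  | nil => rfl
  | cons q e => simp at hp

/-- Vertices related by a bisimulation that matches the outgoing edges one to one have equally many
walks. -/
theorem WalksFrom.nonempty_equiv_of_bisimulation {V W : Type} [Quiver.{0} V] [Quiver.{0} W]
    (B : V → W → Prop)
    (hB : ∀ u w, B u w → ∃ e : Quiver.Star u ≃ Quiver.Star w, ∀ s, B s.1 (e s).1) (n : ℕ) :
    ∀ u w, B u w → Nonempty (WalksFrom n u ≃ WalksFrom n w) := by
  induction n with
  | zero =>
    intro u w _
    obtain ⟨e⟩ := WalksFrom.zero_nonempty_equiv u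
    obtain ⟨e'⟩ := WalksFrom.zero_nonempty_equiv w
    exact ⟨e.trans e'.symm⟩
  | succ n ih =>
    intro u w h
    obtain ⟨e, he⟩ := hB u w h
    exact ⟨(WalksFrom.succEquiv n u).trans ((Equiv.sigmaCongr e fun s => (ih _ _ (he s)).some).trans
      (WalksFrom.succEquiv n w).symm)⟩

/-! ### Necklaces and states -/

/-- Walks on necklaces lift uniquely to walks on states. -/
theorem card_walksFrom_necklace {d L : ℕ} (n : ℕ) (u : ExclusionState d L) :
    Nat.card (WalksFrom n u.necklace) = Nat.card (WalksFrom n u) := by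
  refine (Nat.card_congr (WalksFrom.nonempty_equiv_of_bisimulation
    (fun (u : ExclusionState d L) (b : Necklace d L) => u.necklace = b) ?_ n u _ rfl).some).symm
  rintro u _ rfl
  -- Edges of the multigraph start at a chosen representative, which may be a rotation of `u`;
  -- `jumpsInto_equiv` bridges the difference.
  have h : (Quotient.out u.necklace).necklace = u.necklace := Quotient.out_eq _
  have e := fun b => ExclusionState.jumpsInto_equiv h b
  let f : Quiver.Star u ≃ Σ b : Necklace d L, u.JumpsInto b :=
    { toFun := fun s => ⟨s.1.necklace, s.1, rfl, s.2.down⟩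
      invFun := fun s => ⟨s.2.1, ⟨s.2.2.2⟩⟩
      left_inv := fun s => rfl
      right_inv := by
        rintro ⟨_, v, rfl, hv⟩
        rfl }
  exact ⟨f.trans (Equiv.sigmaCongrRight fun b => (e b).some.symm), fun s => rfl⟩

/-! ### Adding a cell to a cylindric shape of period `(3, L)` -/

namespace CylindricShape

theorem row_add_mul {d L : ℕ} (lam : CylindricShape d L) (i k : ℤ) :
    lam.row (i + k * d) = lam.row i - k * L := by
  induction k using Int.induction_on with
  | zero => simp
  | succ m ih =>
    have h1 := lam.periodic (i + m * d)
    rw [show i + ((m : ℤ) + 1) * d = i + m * d + d by ring]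
    linarith
  | pred m ih =>
    have h1 := lam.periodic (i + (-(m : ℤ) - 1) * d)
    rw [show i + (-(m : ℤ) - 1) * d + d = i + -(m : ℤ) * d by ring] at h1
    linarith

variable {L : ℕ}

theorem row_add_three_mul (lam : CylindricShape 3 L) (i k : ℤ) :
    lam.row (i + 3 * k) = lam.row i - k * L := by
  rw [mul_comm, ← lam.row_add_mul i k]; rfl

/-- The rows `1`, `2`, `3` to which a cell can be added; `i` stands for the row `i + 1`. -/
abbrev Addable (lam : CylindricShape 3 L) : Type :=
  {i : Fin 3 // lam.row (i.val + 1) < lam.row i.val}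

/-- The shape obtained by adding a cell at the end of the row `i + 1` (and its translates). -/
def add (lam : CylindricShape 3 L) (i : Addable lam) : CylindricShape 3 L where
  row m := if (3 : ℤ) ∣ m - (i.1.val + 1) then lam.row m + 1 else lam.row m
  antitone_row := by
    intro m m' h
    have h0 := lam.antitone_row h
    by_cases hm : (3 : ℤ) ∣ m - (i.1.val + 1)
    · simp only [if_pos hm]
      split_ifs <;> omega
    · simp only [if_neg hm]
      split_ifs with hm'
      -- The only danger is that the lower row `m'` grows and `m` does not. Then `m` is at or above
      -- row `m' - 1`, which is strictly longer than row `m'` by addability.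
      · obtain ⟨q, hq⟩ := hm'
        have hlt := i.2
        have h1 := lam.row_add_three_mul (i.1.val + 1) q
        have h2 := lam.row_add_three_mul i.1.val q
        have h3 : m ≤ i.1.val + 3 * q := by
          have : m ≠ m' := fun e => hm (e ▸ ⟨q, hq⟩)
          omega
        have h4 := lam.antitone_row h3
        rw [show m' = i.1.val + 1 + 3 * q by omega]
        linarith
      · exact h0
  periodic := by
    intro m
    have h := lam.periodic m
    have : (3 : ℤ) ∣ m - (i.1.val + 1) ↔ (3 : ℤ) ∣ m + (3 : ℕ) - (i.1.val + 1) := by omega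
    simp only [this]
    split_ifs <;> omega

theorem add_row (lam : CylindricShape 3 L) (i : Addable lam) (m : ℤ) :
    (lam.add i).row m = if (3 : ℤ) ∣ m - (i.1.val + 1) then lam.row m + 1 else lam.row m := rfl

/-- The number of ways to add `n` cells one by one. -/
def growthCount : ℕ → CylindricShape 3 L → ℕ
  | 0, _ => 1
  | n + 1, lam => ∑ i : Addable lam, growthCount n (lam.add i)

/-- A common recursion for walks and for tableaux. Finiteness is carried along because the
cardinality of a sigma type is a sum only for finite fibres. -/
theorem finite_and_card_eq_growthCount {S : Type} (X : ℕ → S → Type) (φ : CylindricShape 3 L → S)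
    (h0 : ∀ lam, Nonempty (X 0 (φ lam) ≃ Unit))
    (hs : ∀ n lam, Nonempty (X (n + 1) (φ lam) ≃ Σ i : Addable lam, X n (φ (lam.add i)))) (n : ℕ) :
    ∀ lam, Finite (X n (φ lam)) ∧ Nat.card (X n (φ lam)) = growthCount n lam := by
  induction n with
  | zero =>
    intro lam
    obtain ⟨e⟩ := h0 lam
    exact ⟨Finite.of_equiv _ e.symm, by simp [Nat.card_congr e, growthCount]⟩
  | succ n ih =>
    intro lam
    obtain ⟨e⟩ := hs n lam
    have := fun i : Addable lam => (ih (lam.add i)).1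
    refine ⟨Finite.of_equiv _ e.symm, ?_⟩
    rw [Nat.card_congr e, Nat.card_sigma, growthCount]
    exact Finset.sum_congr rfl fun i _ => (ih _).2

/-- If the edges out of `φ lam` correspond to the ways to add a cell to `lam`, then the walks from
`φ lam` are counted by `growthCount`. -/
theorem card_walksFrom_eq_growthCount {V : Type} [Quiver.{0} V] [∀ u v : V, Subsingleton (u ⟶ v)]
    (φ : CylindricShape 3 L → V)
    (hinj : ∀ lam, Function.Injective fun i : Addable lam => φ (lam.add i))
    (hmem : ∀ lam (i : Addable lam), Nonempty (φ lam ⟶ φ (lam.add i)))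
    (hsurj : ∀ lam v, (φ lam ⟶ v) → ∃ i : Addable lam, φ (lam.add i) = v) (n : ℕ)
    (lam : CylindricShape 3 L) :
    Nat.card (WalksFrom n (φ lam)) = growthCount n lam := by
  refine (finite_and_card_eq_growthCount (fun n u => WalksFrom n u) φ
    (fun lam => WalksFrom.zero_nonempty_equiv _) (fun n lam => ?_) n lam).2
  let f : Addable lam → Quiver.Star (φ lam) := fun i => ⟨φ (lam.add i), (hmem lam i).some⟩
  have hf : Function.Bijective f := by
    constructor
    · intro i i' h
      exact hinj lam (congrArg Sigma.fst h)
    · rintro ⟨v, e⟩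
      obtain ⟨i, rfl⟩ := hsurj lam v e
      exact ⟨i, Sigma.ext rfl (heq_of_eq (Subsingleton.elim _ _))⟩
  exact ⟨(WalksFrom.succEquiv n (φ lam)).trans
    (Equiv.sigmaCongrLeft (β := fun s : Quiver.Star (φ lam) => WalksFrom n s.1)
      (Equiv.ofBijective f hf)).symm⟩

/-- The differences of consecutive rows. -/
def gap (lam : CylindricShape 3 L) (i : Fin 3) : ℤ := lam.row i.val - lam.row (i.val + 1)

theorem gap_nonneg (lam : CylindricShape 3 L) (i : Fin 3) : 0 ≤ lam.gap i :=
  sub_nonneg.2 (lam.antitone_row (by omega))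

theorem gap_pos_iff (lam : CylindricShape 3 L) (i : Fin 3) :
    0 < lam.gap i ↔ lam.row (i.val + 1) < lam.row i.val := sub_pos

theorem sum_gap (lam : CylindricShape 3 L) : ∑ i, lam.gap i = L := by
  have := lam.periodic 0
  simp [Fin.sum_univ_three, gap] at this ⊢
  linarith

/-- A longer row closes the gap above it by one and opens the gap below it by one. For row `3` the
gap below is gap `0`, because row `0` is a translate of row `3`. -/
theorem gap_add (lam : CylindricShape 3 L) (i : Addable lam) :
    (lam.add i).gap = lam.gap + simplexStep i.1 := by
  obtain ⟨i, hi⟩ := i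
  funext j
  simp only [gap, add_row, simplexStep, Pi.add_apply, Pi.sub_apply, Pi.single_apply]
  fin_cases i <;> fin_cases j <;> simp <;> omega

end CylindricShape

/-! ### The weights -/

/-- The coefficients that express numbers of walks in the triangle by numbers of height sequences:
the contribution of the height `j` at the point with barycentric coordinates `a`, `b`, `c`. -/
def weight (j a b c : ℤ) : ℤ :=
  max 0 (min (min (j + 1) (a + b + c - 2 * j + 1))
    (min (min (min (a + 1) (b + 1)) (c + 1))
      (min (min (b + c - j + 1) (a + c - j + 1)) (a + b - j + 1))))

/-- The weight at a point whose coordinates have the sum `s` and the two least values `a ≤ b`. -/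
def sortedWeight (j s a b : ℤ) : ℤ :=
  max 0 (min (min (j + 1) (s - 2 * j + 1)) (min (a + 1) (a + b - j + 1)))

theorem weight_rot (j a b c : ℤ) : weight j a b c = weight j b c a := by
  unfold weight
  rw [show b + c + a = a + b + c by ring, add_comm c a, add_comm b a, min_assoc (a + 1),
    min_comm (a + 1), min_assoc (b + c - j + 1), min_comm (b + c - j + 1)]

/-- The least coordinate and the least pair sum dominate the minimum, so only the two least
coordinates and the total matter. The lemmas up to `weight_cba` treat the six orderings. -/
theorem weight_abc (j : ℤ) {a b c : ℤ} (h : a ≤ b) (h' : b ≤ c) :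
    weight j a b c = sortedWeight j (a + b + c) a b := by
  unfold weight sortedWeight
  rw [min_eq_left (a := a + 1) (by linarith), min_eq_left (a := a + 1) (by linarith),
    min_eq_right (b := a + c - j + 1) (by linarith), min_eq_right (b := a + b - j + 1) (by linarith)]

theorem weight_acb (j : ℤ) {a b c : ℤ} (h : a ≤ c) (h' : c ≤ b) :
    weight j a b c = sortedWeight j (a + b + c) a c := by
  unfold weight sortedWeight
  rw [min_eq_left (a := a + 1) (by linarith), min_eq_left (a := a + 1) (by linarith),
    min_eq_right (b := a + c - j + 1) (by linarith), min_eq_left (b := a + b - j + 1) (by linarith)]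

theorem weight_bca (j : ℤ) {a b c : ℤ} (h : b ≤ c) (h' : c ≤ a) :
    weight j a b c = sortedWeight j (a + b + c) b c := by
  rw [weight_rot, weight_abc j h h', show b + c + a = a + b + c by ring]

theorem weight_bac (j : ℤ) {a b c : ℤ} (h : b ≤ a) (h' : a ≤ c) :
    weight j a b c = sortedWeight j (a + b + c) b a := by
  rw [weight_rot, weight_acb j h h', show b + c + a = a + b + c by ring]

theorem weight_cab (j : ℤ) {a b c : ℤ} (h : c ≤ a) (h' : a ≤ b) :
    weight j a b c = sortedWeight j (a + b + c) c a := by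
  rw [weight_rot, weight_rot, weight_abc j h h', show c + a + b = a + b + c by ring]

theorem weight_cba (j : ℤ) {a b c : ℤ} (h : c ≤ b) (h' : b ≤ a) :
    weight j a b c = sortedWeight j (a + b + c) c b := by
  rw [weight_rot, weight_rot, weight_acb j h h', show c + a + b = a + b + c by ring]

set_option maxHeartbeats 4000000 in
-- A finite check on a piecewise linear function. Exchanging `b` and `c` does not preserve the set
-- of steps, so both orders of `b` and `c` must be treated.
theorem weight_neighbours_of_le (j a b c : ℤ) (hj : 0 ≤ j) (ha : 0 ≤ a) (h1 : a ≤ b) (h2 : a ≤ c) :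
    (2 * j < a + b + c → weight j (a - 1) (b + 1) c + weight j a (b - 1) (c + 1) +
      weight j (a + 1) b (c - 1) = weight (j - 1) a b c + weight j a b c + weight (j + 1) a b c) ∧
    (2 * j = a + b + c → weight j (a - 1) (b + 1) c + weight j a (b - 1) (c + 1) +
      weight j (a + 1) b (c - 1) = weight (j - 1) a b c) := by
  have e1 : weight j (a - 1) (b + 1) c = sortedWeight j (a + b + c) (a - 1) (min (b + 1) c) := by
    rcases le_total (b + 1) c with h | h
    · rw [weight_abc j (by omega) h, min_eq_left h]; congr 1; ring
    · rw [weight_acb j (by omega) h, min_eq_right h]; congr 1; ring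
  have e (k : ℤ) : weight k a b c = sortedWeight k (a + b + c) a (min b c) := by
    rcases le_total b c with h | h
    · rw [weight_abc k h1 h, min_eq_left h]
    · rw [weight_acb k h2 h, min_eq_right h]
  -- A step changes the difference of two coordinates by at most `2`; these alternatives therefore
  -- decide how the coordinates of the neighbours are ordered.
  have hb : b = a ∨ b = a + 1 ∨ a + 2 ≤ b := by omega
  have hc : c = a ∨ c = a + 1 ∨ a + 2 ≤ c := by omega
  have hd : b + 2 ≤ c ∨ b + 1 = c ∨ b = c ∨ b = c + 1 ∨ c + 2 ≤ b := by omega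
  rw [e1, e, e, e]
  rcases hb with hb | hb | hb <;> rcases hc with hc | hc | hc <;>
    rcases hd with hd | hd | hd | hd | hd <;>
  first
  | (exfalso; omega)
  | ((first
      | rw [weight_abc j (show a ≤ b - 1 by omega) (show b - 1 ≤ c + 1 by omega)]
      | rw [weight_acb j (show a ≤ c + 1 by omega) (show c + 1 ≤ b - 1 by omega)]
      | rw [weight_bac j (show b - 1 ≤ a by omega) (show a ≤ c + 1 by omega)])
     (first
      | rw [weight_abc j (show a + 1 ≤ b by omega) (show b ≤ c - 1 by omega)]
      | rw [weight_acb j (show a + 1 ≤ c - 1 by omega) (show c - 1 ≤ b by omega)]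
      | rw [weight_bac j (show b ≤ a + 1 by omega) (show a + 1 ≤ c - 1 by omega)]
      | rw [weight_bca j (show b ≤ c - 1 by omega) (show c - 1 ≤ a + 1 by omega)]
      | rw [weight_cab j (show c - 1 ≤ a + 1 by omega) (show a + 1 ≤ b by omega)]
      | rw [weight_cba j (show c - 1 ≤ b by omega) (show b ≤ a + 1 by omega)])
     clear e e1
     unfold sortedWeight
     constructor <;> grind)

/-- Cyclic rotation permutes the three neighbours and preserves `weight`, so the least coordinate
may be taken to be the first. -/
theorem weight_neighbours (j a b c : ℤ) (hj : 0 ≤ j) (ha : 0 ≤ a) (hb : 0 ≤ b) (hc : 0 ≤ c)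
    (h : 2 * j < a + b + c) :
    weight j (a - 1) (b + 1) c + weight j a (b - 1) (c + 1) + weight j (a + 1) b (c - 1) =
      weight (j - 1) a b c + weight j a b c + weight (j + 1) a b c := by
  have hB : b ≤ c → b ≤ a → _ :=
    fun h1 h2 => (weight_neighbours_of_le j b c a hj hb h1 h2).1 (by linarith)
  have hC : c ≤ a → c ≤ b → _ :=
    fun h1 h2 => (weight_neighbours_of_le j c a b hj hc h1 h2).1 (by linarith)
  rw [← weight_rot j a (b - 1) (c + 1), ← weight_rot j (a - 1) (b + 1) c,
    ← weight_rot j (a + 1) b (c - 1), ← weight_rot _ a b c, ← weight_rot _ a b c,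
    ← weight_rot _ a b c] at hB
  rw [weight_rot j c (a - 1) (b + 1), weight_rot j (c - 1) (a + 1) b,
    weight_rot j (c + 1) a (b - 1), weight_rot _ c a b, weight_rot _ c a b,
    weight_rot _ c a b] at hC
  rcases le_total a b with h1 | h1
  · rcases le_total a c with h2 | h2
    · exact (weight_neighbours_of_le j a b c hj ha h1 h2).1 h
    · linarith [hC h2 (h2.trans h1)]
  · rcases le_total b c with h2 | h2
    · linarith [hB h2 h1]
    · linarith [hC (h2.trans h1) h2]

theorem weight_neighbours_top (j a b c : ℤ) (hj : 0 ≤ j) (ha : 0 ≤ a) (hb : 0 ≤ b) (hc : 0 ≤ c)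
    (h : 2 * j = a + b + c) :
    weight j (a - 1) (b + 1) c + weight j a (b - 1) (c + 1) + weight j (a + 1) b (c - 1) =
      weight (j - 1) a b c := by
  have hB : b ≤ c → b ≤ a → _ :=
    fun h1 h2 => (weight_neighbours_of_le j b c a hj hb h1 h2).2 (by linarith)
  have hC : c ≤ a → c ≤ b → _ :=
    fun h1 h2 => (weight_neighbours_of_le j c a b hj hc h1 h2).2 (by linarith)
  rw [← weight_rot j a (b - 1) (c + 1), ← weight_rot j (a - 1) (b + 1) c,
    ← weight_rot j (a + 1) b (c - 1), ← weight_rot _ a b c] at hB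
  rw [weight_rot j c (a - 1) (b + 1), weight_rot j (c - 1) (a + 1) b,
    weight_rot j (c + 1) a (b - 1), weight_rot _ c a b] at hC
  rcases le_total a b with h1 | h1
  · rcases le_total a c with h2 | h2
    · exact (weight_neighbours_of_le j a b c hj ha h1 h2).2 h
    · linarith [hC h2 (h2.trans h1)]
  · rcases le_total b c with h2 | h2
    · linarith [hB h2 h1]
    · linarith [hC (h2.trans h1) h2]

/-- In each case an entry of the minimum is `0`. Hence terms one step outside the triangle or the
range of heights may be added freely. -/
theorem weight_eq_zero (j a b c : ℤ)
    (h : j = -1 ∨ a = -1 ∨ b = -1 ∨ c = -1 ∨ 2 * j = a + b + c + 1) : weight j a b c = 0 := by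
  refine max_eq_left ?_
  simp only [min_le_iff]
  omega

theorem weight_zero (a b c : ℤ) (ha : 0 ≤ a) (hb : 0 ≤ b) (hc : 0 ≤ c) : weight 0 a b c = 1 := by
  refine le_antisymm (max_le (by norm_num) ?_) (le_max_of_le_right ?_)
  · simp only [min_le_iff]; omega
  · simp only [le_min_iff]; omega

/-- The entry `b + c - j + 1` of the minimum is `1 - j` here. -/
theorem weight_corner (j L : ℤ) (hj : 1 ≤ j) : weight j L 0 0 = 0 := by
  refine max_eq_left ?_
  simp only [min_le_iff]
  omega

/-! ### Motzkin paths as height sequences -/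

/-- The admissible steps of the heights of the Motzkin paths counted by `boundedMotzkin _ L`. -/
def HeightStep (L : ℕ) (x y : ℤ) : Prop :=
  0 ≤ x ∧ 0 ≤ y ∧ x - 1 ≤ y ∧ y ≤ x + 1 ∧ x + y < L

/-- The height sequences of length `n` that lead from `x` to `0`. -/
def HeightPath (L n : ℕ) (x : ℤ) : Type :=
  {p : Fin (n + 1) → ℤ // p 0 = x ∧ p (Fin.last n) = 0 ∧
    ∀ k : Fin n, HeightStep L (p k.castSucc) (p k.succ)}

/-- Removing the first height. -/
def HeightPath.succEquiv (L n : ℕ) (x : ℤ) :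
    HeightPath L (n + 1) x ≃ Σ y : {y : ℤ // HeightStep L x y}, HeightPath L n y where
  toFun p := ⟨⟨p.1 1, by simpa [p.2.1] using p.2.2.2 0⟩, fun k => p.1 k.succ, rfl,
    by simpa using p.2.2.1, fun k => by simpa using p.2.2.2 k.succ⟩
  invFun q := ⟨Fin.cons x q.2.1, by simp, by
    rw [← Fin.succ_last, Fin.cons_succ]; exact q.2.2.2.1, fun k => by
    refine Fin.cases ?_ (fun k => ?_) k
    · have := q.1.2
      simp only [Fin.castSucc_zero, Fin.cons_zero, Fin.cons_succ]
      rwa [q.2.2.1]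
    · simpa [← Fin.succ_castSucc] using q.2.2.2.2 k⟩
  left_inv p := by
    refine Subtype.ext (funext fun k => ?_)
    refine Fin.cases ?_ (fun k => ?_) k
    · simp [p.2.1]
    · simp
  right_inv := by
    rintro ⟨⟨y, hy⟩, p, hp0, hp⟩
    change p 0 = y at hp0
    subst hp0
    rfl

/-- The number of height sequences of length `n` from `x` to `0`, computed recursively. -/
def heightCount (L : ℕ) : ℕ → ℤ → ℕ
  | 0, x => if x = 0 then 1 else 0
  | n + 1, x => if x < 0 then 0 else
      (if 0 < x ∧ 2 * x ≤ L then heightCount L n (x - 1) else 0) +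
      (if 2 * x < L then heightCount L n x else 0) +
      (if 2 * x + 1 < L then heightCount L n (x + 1) else 0)

instance (L : ℕ) (x y : ℤ) : Decidable (HeightStep L x y) := by
  unfold HeightStep; infer_instance

theorem HeightPath.finite_and_card (L n : ℕ) :
    ∀ x, Finite (HeightPath L n x) ∧ Nat.card (HeightPath L n x) = heightCount L n x := by
  induction n with
  | zero =>
    intro x
    have : Subsingleton (HeightPath L 0 x) := ⟨fun p q => Subtype.ext (funext fun k => by
      rw [Fin.fin_one_eq_zero k, p.2.1, q.2.1])⟩
    refine ⟨inferInstance, ?_⟩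
    by_cases hx : x = 0
    · subst hx
      have : Nonempty (HeightPath L 0 0) := ⟨fun _ => 0, rfl, rfl, fun k => k.elim0⟩
      simp [heightCount]
    · have : IsEmpty (HeightPath L 0 x) := ⟨fun p => hx (p.2.1.symm.trans p.2.2.1)⟩
      simp [heightCount, hx]
  | succ n ih =>
    intro x
    have hS : {y : ℤ | HeightStep L x y} =
        (({x - 1, x, x + 1} : Finset ℤ).filter fun y => HeightStep L x y) := by
      ext y
      simp only [Set.mem_ofPred_eq, Finset.coe_filter, Finset.mem_insert, Finset.mem_singleton]
      constructor
      · intro h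
        exact ⟨by obtain ⟨_, _, _, _, _⟩ := h; omega, h⟩
      · exact fun h => h.2
    have hfin : Finite {y : ℤ // HeightStep L x y} := by
      change Finite ({y : ℤ | HeightStep L x y} : Set ℤ)
      rw [hS]; exact Finset.finite_toSet _
    have := Fintype.ofFinite {y : ℤ // HeightStep L x y}
    have hfin' := fun y => (ih y).1
    refine ⟨Finite.of_equiv _ (HeightPath.succEquiv L n x).symm, ?_⟩
    rw [Nat.card_congr (HeightPath.succEquiv L n x), Nat.card_sigma]
    simp only [(ih _).2]
    rw [← Finset.sum_subtype (({x - 1, x, x + 1} : Finset ℤ).filter fun y => HeightStep L x y)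
      (fun y => by rw [← Finset.mem_coe, ← hS]; rfl) (fun y => heightCount L n y), Finset.sum_filter,
      Finset.sum_insert (by simp; omega), Finset.sum_insert (by simp), Finset.sum_singleton, ← add_assoc]
    rw [heightCount]
    by_cases hx : x < 0
    · rw [if_pos hx, if_neg (fun h => by have := h.1; omega), if_neg (fun h => by have := h.1; omega),
        if_neg (fun h => by have := h.1; omega), add_zero, add_zero]
    · rw [if_neg hx]
      exact congrArg₂ _ (congrArg₂ _ (if_congr (by unfold HeightStep; omega) rfl rfl)
        (if_congr (by unfold HeightStep; omega) rfl rfl))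
        (if_congr (by unfold HeightStep; omega) rfl rfl)

/-- The Motzkin paths counted by `boundedMotzkin n L` correspond to height sequences. -/
theorem boundedMotzkin_eq_heightCount (n L : ℕ) :
    boundedMotzkin n L = heightCount L n 0 := by
  rw [← (HeightPath.finite_and_card L n 0).2]
  have key : ∀ Q : MotzkinPath n → Prop,
      (∀ p, Q p ↔ ∀ k : Fin n, HeightStep L (p.point k.castSucc).2 (p.point k.succ).2) →
      Nat.card {p : MotzkinPath n // Q p} = Nat.card (HeightPath L n 0) := by
    intro Q hQ
    refine Nat.card_congr (Equiv.ofBijective (fun p => ⟨fun k => (p.1.point k).2, by simp [p.1.start],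
      by simp [p.1.finish], (hQ p.1).1 p.2⟩) ⟨?_, ?_⟩)
    · rintro ⟨p, hp⟩ ⟨q, hq⟩ h
      have h : ∀ k, (p.point k).2 = (q.point k).2 := congrFun (congrArg Subtype.val h)
      -- The first coordinates are forced, so the heights determine the path.
      have hx : ∀ (p : MotzkinPath n) (k : Fin (n + 1)), (p.point k).1 = k.val := by
        intro p k
        induction k using Fin.induction with
        | zero => simp [p.start]
        | succ k ih =>
          have := p.step k
          simp only [Set.mem_insert_iff, Set.mem_singleton_iff, Prod.ext_iff, Prod.fst_sub] at this
          simp only [Fin.val_castSucc] at ih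
          simp only [Fin.val_succ]
          push_cast
          omega
      have : p.point = q.point := funext fun k => Prod.ext ((hx p k).trans (hx q k).symm) (h k)
      cases p; cases q; cases this; rfl
    · rintro ⟨f, hf0, hfn, hf⟩
      refine ⟨⟨⟨fun k => (k.val, f k), by simp [hf0], by simp [hfn], fun k => ?_, fun k => ?_⟩, ?_⟩, rfl⟩
      · obtain ⟨h1, h2, h3, h4, h5⟩ := hf k
        simp only [Fin.val_succ, Fin.val_castSucc, Set.mem_insert_iff, Set.mem_singleton_iff,
          Prod.ext_iff, Prod.fst_sub, Prod.snd_sub]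
        push_cast
        omega
      · refine Fin.cases (by simp [hf0]) (fun k => (hf k).2.1) k
      · exact (hQ _).2 hf
  have hstep : ∀ (p : MotzkinPath n) (k : Fin n), (p.point k.castSucc).2 - 1 ≤ (p.point k.succ).2 ∧
      (p.point k.succ).2 ≤ (p.point k.castSucc).2 + 1 := by
    intro p k
    have := p.step k
    simp only [Set.mem_insert_iff, Set.mem_singleton_iff, Prod.ext_iff, Prod.fst_sub,
      Prod.snd_sub] at this
    omega
  have hbd : ∀ (p : MotzkinPath n), (∀ k : Fin n, HeightStep L (p.point k.castSucc).2 (p.point k.succ).2) →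
      ∀ k, (p.point k).2 ≤ (L / 2 : ℕ) := by
    intro p h k
    refine Fin.cases (by rw [p.start]; exact Int.natCast_nonneg _) (fun k => ?_) k
    obtain ⟨h1, h2, h3, h4, h5⟩ := h k
    omega
  unfold boundedMotzkin motzkinCount motzkinCount'
  -- With `h = L / 2`, the condition `x + y < L` allows an up step exactly when `x < h`, and a level
  -- step when `x < h` for even `L`, `x ≤ h` for odd `L`.
  split_ifs with he
  · refine key _ fun p => ⟨fun h k => ?_, fun h => ⟨hbd p h, fun k hk => ?_⟩⟩
    · have h1 := h.1 k.castSucc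
      have h2 := h.1 k.succ
      have h3 := h.2 k
      have := hstep p k
      refine ⟨p.nonneg _, p.nonneg _, this.1, this.2, ?_⟩
      omega
    · obtain ⟨h1, h2, h3, h4, h5⟩ := h k
      rw [Nat.even_iff] at he
      omega
  · refine key _ fun p => ⟨fun h k => ?_, hbd p⟩
    have h1 := h k.castSucc
    have h2 := h k.succ
    have := hstep p k
    rw [Nat.even_iff] at he
    refine ⟨p.nonneg _, p.nonneg _, this.1, this.2, ?_⟩
    omega

/-! ### Counting walks in the triangle by height sequences -/

/-- The weight identities shift `j` in the weight, the recursion of `heightCount` shifts it in the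
count. Re-indexing exchanges the two, since up and down steps are reverses of each other. -/
theorem sum_weight_neighbours (L n : ℕ) (a b c : ℤ) (ha : 0 ≤ a) (hb : 0 ≤ b) (hc : 0 ≤ c)
    (hL : a + b + c = L) :
    ∑ j ∈ Finset.range (L / 2 + 1), (weight j (a - 1) (b + 1) c + weight j a (b - 1) (c + 1) +
        weight j (a + 1) b (c - 1)) * (heightCount L n j : ℤ) =
      ∑ j ∈ Finset.range (L / 2 + 1), weight j a b c * (heightCount L (n + 1) j : ℤ) := by
  let W : ℕ → ℤ := fun j => heightCount L n j
  let G : ℤ → ℤ := fun j => weight j a b c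
  have hl : ∀ j ∈ Finset.range (L / 2 + 1), (weight j (a - 1) (b + 1) c + weight j a (b - 1) (c + 1) +
      weight j (a + 1) b (c - 1)) * (heightCount L n j : ℤ) =
      G (j - 1) * W j + (if 2 * j < L then G j * W j else 0) +
        (if j < L / 2 then G (j + 1) * W j else 0) := by
    intro j hj
    rw [Finset.mem_range] at hj
    by_cases h : 2 * j < L
    · rw [weight_neighbours j a b c (by omega) ha hb hc (by omega), if_pos h]
      by_cases h' : j < L / 2
      · rw [if_pos h']; simp only [G, W]; ring
      -- Here `L = 2 * j + 1`, so `j + 1` is just above the range of heights.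
      · rw [if_neg h', weight_eq_zero (j + 1) a b c (by omega)]; simp only [G, W]; ring
    · rw [weight_neighbours_top j a b c (by omega) ha hb hc (by omega), if_neg h,
        if_neg (by omega)]
      simp only [G, W]; ring
  have hr : ∀ j ∈ Finset.range (L / 2 + 1), weight j a b c * (heightCount L (n + 1) j : ℤ) =
      (if 0 < j then G j * W (j - 1) else 0) + (if 2 * j < L then G j * W j else 0) +
        (if j < L / 2 then G j * W (j + 1) else 0) := by
    intro j hj
    rw [Finset.mem_range] at hj
    have h1 : heightCount L (n + 1) (j : ℤ) = (if 0 < j then heightCount L n (j - 1 : ℕ) else 0) +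
        (if 2 * j < L then heightCount L n j else 0) +
        (if j < L / 2 then heightCount L n (j + 1 : ℕ) else 0) := by
      rw [heightCount, if_neg (by omega)]
      refine congrArg₂ _ (congrArg₂ _ ?_ (if_congr (by omega) rfl rfl)) (if_congr (by omega) rfl rfl)
      by_cases h : 0 < j
      · rw [if_pos h, if_pos (by omega), Nat.cast_sub h]; rfl
      · rw [if_neg h, if_neg (by omega)]
    rw [h1]
    simp only [G, W]
    push_cast
    simp only [mul_add, mul_ite, mul_zero]
  rw [Finset.sum_congr rfl hl, Finset.sum_congr rfl hr]
  simp only [Finset.sum_add_distrib]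
  have e1 : ∑ j ∈ Finset.range (L / 2 + 1), G (j - 1) * W j =
      ∑ j ∈ Finset.range (L / 2 + 1), (if j < L / 2 then G j * W (j + 1) else 0) := by
    rw [Finset.sum_range_succ', Finset.sum_range_succ, if_neg (lt_irrefl _),
      show G ((0 : ℕ) - 1) = 0 from weight_eq_zero _ a b c (by simp), zero_mul]
    refine congrArg (· + (0 : ℤ)) (Finset.sum_congr rfl fun j hj => ?_)
    rw [if_pos (Finset.mem_range.1 hj)]
    simp
  have e2 : ∑ j ∈ Finset.range (L / 2 + 1), (if 0 < j then G j * W (j - 1) else 0) =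
      ∑ j ∈ Finset.range (L / 2 + 1), (if j < L / 2 then G (j + 1) * W j else 0) := by
    rw [Finset.sum_range_succ', Finset.sum_range_succ, if_neg (lt_irrefl _), if_neg (lt_irrefl _)]
    refine congrArg (· + (0 : ℤ)) (Finset.sum_congr rfl fun j hj => ?_)
    rw [if_pos (Finset.mem_range.1 hj), if_pos (Nat.succ_pos j)]
    simp
  rw [e1, e2]
  ring

namespace CylindricShape

variable {L : ℕ}

theorem growthCount_eq_sum (n : ℕ) : ∀ lam : CylindricShape 3 L, (growthCount n lam : ℤ) =
    ∑ j ∈ Finset.range (L / 2 + 1),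
      weight j (lam.gap 0) (lam.gap 1) (lam.gap 2) * (heightCount L n j : ℤ) := by
  induction n with
  | zero =>
    intro lam
    rw [Finset.sum_eq_single_of_mem 0 (by simp)]
    · simp [growthCount, heightCount, weight_zero _ _ _ (lam.gap_nonneg 0) (lam.gap_nonneg 1)
        (lam.gap_nonneg 2)]
    · intro j _ hj
      simp [heightCount, hj]
  | succ n ih =>
    intro lam
    have hL := lam.sum_gap
    rw [Fin.sum_univ_three] at hL
    rw [← sum_weight_neighbours L n _ _ _ (lam.gap_nonneg 0) (lam.gap_nonneg 1) (lam.gap_nonneg 2) hL,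
      growthCount]
    push_cast
    simp only [ih, gap_add]
    let T : Fin 3 → ℤ := fun i => ∑ j ∈ Finset.range (L / 2 + 1),
      weight j ((lam.gap + simplexStep i) 0) ((lam.gap + simplexStep i) 1)
        ((lam.gap + simplexStep i) 2) * (heightCount L n j : ℤ)
    -- A row that cannot be extended has gap `0`; its step leads to a coordinate `-1`, where all
    -- weights vanish.
    have hT : ∑ i : Addable lam, T i.1 = ∑ i, T i := by
      rw [← Finset.sum_subtype (Finset.univ.filter fun i : Fin 3 =>
        lam.row (i.val + 1) < lam.row i.val) (by simp) T, Finset.sum_filter]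
      refine Finset.sum_congr rfl fun i _ => ?_
      split_ifs with hi
      · rfl
      · have h0 : lam.gap i = 0 := le_antisymm (not_lt.1 fun h => hi ((lam.gap_pos_iff i).1 h))
          (lam.gap_nonneg i)
        refine (Finset.sum_eq_zero fun j _ => ?_).symm
        rw [weight_eq_zero, zero_mul]
        right
        fin_cases i <;> simp at h0 <;> simp [simplexStep, h0]
    refine hT.trans ?_
    simp [T, Fin.sum_univ_three, simplexStep, Pi.single_apply, ← Finset.sum_add_distrib, ← add_mul,
      sub_eq_add_neg]

theorem growthCount_of_corner (n : ℕ) (lam : CylindricShape 3 L) (k : Fin 3)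
    (h : lam.gap = Pi.single k (L : ℤ)) : growthCount n lam = heightCount L n 0 := by
  have := growthCount_eq_sum n lam
  rw [h, Finset.sum_eq_single_of_mem 0 (by simp)] at this
  · have hw : weight (0 : ℕ) ((Pi.single k (L : ℤ) : Fin 3 → ℤ) 0) ((Pi.single k (L : ℤ) : Fin 3 → ℤ) 1)
        ((Pi.single k (L : ℤ) : Fin 3 → ℤ) 2) = 1 := by
      refine weight_zero _ _ _ ?_ ?_ ?_ <;> rw [Pi.single_apply] <;> split_ifs <;> simp
    rw [hw, one_mul] at this
    exact_mod_cast this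
  · intro j _ hj
    have h1 := weight_corner j L (by omega)
    have h2 := h1
    rw [weight_rot] at h2
    have h3 := h2
    rw [weight_rot] at h3
    fin_cases k <;> simp [h1, h2, h3]

end CylindricShape

/-! ### Walks in simplices -/

instance Simplex.subsingleton_hom {d L : ℕ} (x y : Simplex d L) : Subsingleton (x ⟶ y) :=
  inferInstanceAs (Subsingleton (PLift _))

/-- Among the steps, only `s_i` is negative at `i`. -/
theorem simplexStep_injective {d : ℕ} (hd : 2 ≤ d) :
    Function.Injective (simplexStep : Fin d → Fin d → ℤ) := by
  obtain ⟨m, rfl⟩ : ∃ m, d = m + 2 := ⟨d - 2, by omega⟩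
  intro i j h
  by_contra hne
  have := congrFun h i
  have h1 : i ≠ i + 1 := by simp
  simp only [simplexStep, finRotate_apply, Pi.sub_apply, Pi.single_eq_same,
    Pi.single_eq_of_ne h1, Pi.single_eq_of_ne hne] at this
  by_cases h2 : i = j + 1
  · simp [h2] at this
  · simp [Pi.single_eq_of_ne h2] at this

namespace CylindricShape

variable {L : ℕ}

/-- The differences of consecutive rows as a point of the triangle. -/
def toTriangle (lam : CylindricShape 3 L) : Simplex 3 L :=
  ⟨fun i => (lam.gap i).toNat, by
    zify
    simp only [Int.toNat_of_nonneg (lam.gap_nonneg _), lam.sum_gap]⟩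

theorem toTriangle_apply (lam : CylindricShape 3 L) (i : Fin 3) :
    ((lam.toTriangle.1 i : ℕ) : ℤ) = lam.gap i :=
  Int.toNat_of_nonneg (lam.gap_nonneg i)

theorem toTriangle_eq_iff (lam : CylindricShape 3 L) (x : Simplex 3 L) :
    lam.toTriangle = x ↔ ∀ i, lam.gap i = x.1 i := by
  constructor
  · rintro rfl i
    exact (lam.toTriangle_apply i).symm
  · intro h
    exact Subtype.ext (funext fun i => by zify; rw [toTriangle_apply, h])

/-- The step `s_i` stays in the triangle exactly when gap `i` is positive, that is, when row `i + 1`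
can be extended. -/
theorem card_walksFrom_toTriangle (n : ℕ) (lam : CylindricShape 3 L) :
    Nat.card (WalksFrom n lam.toTriangle) = growthCount n lam := by
  have hadd : ∀ (lam : CylindricShape 3 L) (i : Addable lam) (j : Fin 3),
      (((lam.add i).toTriangle.1 j : ℕ) : ℤ) - (lam.toTriangle.1 j : ℕ) = simplexStep i.1 j := by
    intro lam i j
    rw [toTriangle_apply, toTriangle_apply, gap_add, Pi.add_apply, add_sub_cancel_left]
  refine card_walksFrom_eq_growthCount _ (fun lam i i' h => ?_) (fun lam i => ?_)
    (fun lam v e => ?_) n lam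
  · refine Subtype.ext (simplexStep_injective (by norm_num) (funext fun j => ?_))
    simp only at h
    rw [← hadd, ← hadd, h]
  · exact ⟨⟨i.1, funext fun j => hadd lam i j⟩⟩
  · obtain ⟨i, hi⟩ := e.down
    have hi := congrFun hi
    have hpos : 0 < lam.gap i := by
      have := hi i
      rw [toTriangle_apply] at this
      have h1 : simplexStep i i = -1 := by fin_cases i <;> simp [simplexStep]
      omega
    refine ⟨⟨i, (lam.gap_pos_iff i).1 hpos⟩, Subtype.ext (funext fun j => ?_)⟩
    have h1 := hi j
    have h2 := hadd lam ⟨i, (lam.gap_pos_iff i).1 hpos⟩ j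
    zify
    linarith

/-- A shape whose image in the triangle is the corner `k`. -/
def cornerShape (L : ℕ) (k : Fin 3) : CylindricShape 3 L where
  row m := (zero 3 L).row (m - k.val)
  antitone_row _ _ h := (zero 3 L).antitone_row (by omega)
  periodic m := by
    rw [(zero 3 L).periodic, show m + ((3 : ℕ) : ℤ) - k.val = m - k.val + (3 : ℕ) by ring]

theorem gap_cornerShape (k : Fin 3) : (cornerShape L k).gap = Pi.single k (L : ℤ) := by
  funext i
  fin_cases k <;> fin_cases i <;> simp [gap, cornerShape, zero]

theorem gap_zero : (zero 3 L).gap = Pi.single 0 (L : ℤ) := by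
  funext i
  fin_cases i <;> simp [gap, zero]

theorem toTriangle_cornerShape (k : Fin 3) : (cornerShape L k).toTriangle = Simplex.corner 3 L k := by
  rw [toTriangle_eq_iff, gap_cornerShape]
  intro i
  simp [Simplex.corner, Pi.single_apply]

/-! ### Rows that can be extended -/

theorem exists_eq_row (k : ℤ) : ∃ (i : Fin 3) (q : ℤ), k = i.val + 1 + 3 * q :=
  ⟨⟨((k - 1) % 3).toNat, by omega⟩, (k - 1) / 3, by simp only; omega⟩

theorem exists_addable (lam : CylindricShape 3 L) (k : ℤ) (h : lam.row k < lam.row (k - 1)) :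
    ∃ (i : Addable lam) (q : ℤ), k = i.1.val + 1 + 3 * q := by
  obtain ⟨i, q, rfl⟩ := exists_eq_row k
  refine ⟨⟨i, ?_⟩, q, rfl⟩
  rw [show (i.val : ℤ) + 1 + 3 * q - 1 = i.val + 3 * q by ring] at h
  rw [row_add_three_mul, row_add_three_mul] at h
  linarith

/-- The topmost row of a block of equal rows is extendable. A block has at most three rows, since
row `k - 3` exceeds row `k` by `L ≥ 1`. -/
theorem exists_row_eq_lt (lam : CylindricShape 3 L) (hL : 1 ≤ L) (k : ℤ) :
    ∃ k', lam.row k' = lam.row k ∧ lam.row k' < lam.row (k' - 1) := by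
  have h0 := lam.row_add_three_mul k (-1)
  have h1 := lam.antitone_row (show k - 1 ≤ k by omega)
  have h2 := lam.antitone_row (show k - 1 - 1 ≤ k - 1 by omega)
  rw [show k + 3 * (-1) = k - 1 - 1 - 1 by ring] at h0
  by_cases h3 : lam.row k < lam.row (k - 1)
  · exact ⟨k, rfl, h3⟩
  by_cases h4 : lam.row (k - 1) < lam.row (k - 1 - 1)
  · exact ⟨k - 1, by omega, h4⟩
  · exact ⟨k - 1 - 1, by omega, by omega⟩

theorem row_injective_of_lt (lam : CylindricShape 3 L) {k k' : ℤ} (h : lam.row k < lam.row (k - 1))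
    (h' : lam.row k' < lam.row (k' - 1)) (he : lam.row k = lam.row k') : k = k' := by
  rcases lt_trichotomy k k' with hlt | hlt | hlt
  · have := lam.antitone_row (show k ≤ k' - 1 by omega)
    omega
  · exact hlt
  · have := lam.antitone_row (show k' ≤ k - 1 by omega)
    omega

theorem Addable.lt_row {lam : CylindricShape 3 L} (i : Addable lam) (q : ℤ) :
    lam.row (i.1.val + 1 + 3 * q) < lam.row (i.1.val + 1 + 3 * q - 1) := by
  have := i.2
  rw [show (i.1.val : ℤ) + 1 + 3 * q - 1 = i.1.val + 3 * q by ring, row_add_three_mul,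
    row_add_three_mul]
  linarith

/-! ### The ends of the rows as three points on a cycle -/

section Cycle

variable {m : ℕ}

/-- The end of the row `i + 1`, shifted by `p`, on a cycle of length `m + 1`. -/
def rowEnd (p : ℤ) (lam : CylindricShape 3 (m + 1)) (i : Fin 3) : Fin (m + 1) :=
  ((lam.row (i.val + 1) + p : ℤ) : ZMod (m + 1))

/-- The numbers of rows that end at the points of a cycle of length `m + 1`. -/
def toCycle (p : ℤ) (lam : CylindricShape 3 (m + 1)) : Simplex (m + 1) 3 :=
  ⟨fun j => ∑ i, Pi.single (M := fun _ => ℕ) (lam.rowEnd p i) 1 j, by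
    rw [Finset.sum_comm]
    simp⟩

theorem rowEnd_add (p : ℤ) (lam : CylindricShape 3 (m + 1)) (i : Addable lam) (j : Fin 3) :
    (lam.add i).rowEnd p j = if j = i.1 then lam.rowEnd p j + 1 else lam.rowEnd p j := by
  have h : (3 : ℤ) ∣ (j.val + 1 : ℤ) - (i.1.val + 1) ↔ j = i.1 := by
    rw [Fin.ext_iff]; omega
  rw [rowEnd, add_row]
  simp only [h]
  split_ifs
  · change _ = (((lam.row (j.val + 1) + p : ℤ) : ZMod (m + 1)) + 1 : ZMod (m + 1))
    push_cast
    ring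
  · rfl

theorem toCycle_add (p : ℤ) (lam : CylindricShape 3 (m + 1)) (i : Addable lam) (j : Fin (m + 1)) :
    ((((lam.add i).toCycle p).1 j : ℕ) : ℤ) - ((lam.toCycle p).1 j : ℕ) =
      simplexStep (lam.rowEnd p i.1) j := by
  simp only [toCycle, rowEnd_add, simplexStep, finRotate_apply, Pi.sub_apply, Nat.cast_sum,
    ← Finset.sum_sub_distrib]
  rw [Finset.sum_eq_single i.1]
  · simp [Pi.single_apply]
  · intro i' _ hne
    simp [hne]
  · simp

/-- If two ends agree modulo `L`, a translate of one row has the same length as the other. Both are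
topmost in their block of equal rows, hence they coincide. -/
theorem Addable.eq_of_rowEnd_eq {p : ℤ} {lam : CylindricShape 3 (m + 1)} {i i' : Addable lam}
    (h : lam.rowEnd p i.1 = lam.rowEnd p i'.1) : i = i' := by
  obtain ⟨t, ht⟩ := (ZMod.intCast_eq_intCast_iff_dvd_sub _ _ (m + 1)).1 h
  have h1 := lam.row_add_three_mul (i.1.val + 1) (-t)
  have h2 := lam.row_injective_of_lt (k' := i'.1.val + 1) (i.lt_row (-t))
    (by rw [add_sub_cancel_right]; exact i'.2) (by rw [h1]; linarith)
  refine Subtype.ext (Fin.ext ?_)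
  omega

/-- Several rows may end at the same point of the cycle, but exactly one of the rows `1`, `2`, `3`
ending there can be extended. This matches the single edge for the step at that point. -/
theorem card_walksFrom_toCycle (p : ℤ) (n : ℕ) (lam : CylindricShape 3 (m + 1)) :
    Nat.card (WalksFrom n (lam.toCycle p)) = growthCount n lam := by
  refine card_walksFrom_eq_growthCount (toCycle p) (fun lam i i' h => ?_) (fun lam i => ?_)
    (fun lam v e => ?_) n lam
  · refine Addable.eq_of_rowEnd_eq (p := p) ?_
    -- For `L = 1` the only step is zero and does not determine anything, but the cycle has a single
    -- point.
    rcases Nat.eq_zero_or_pos m with rfl | hm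
    · exact Subsingleton.elim (α := Fin 1) _ _
    · refine simplexStep_injective (by omega) (funext fun j => ?_)
      simp only at h
      rw [← toCycle_add, ← toCycle_add, h]
  · exact ⟨⟨_, funext fun j => toCycle_add p lam i j⟩⟩
  · obtain ⟨j, hj⟩ := e.down
    have hj := congrFun hj
    have hpos : ∃ i, lam.rowEnd p i = j := by
      by_contra! hne
      have h0 : (lam.toCycle p).1 j = 0 := by
        simp only [toCycle]
        exact Finset.sum_eq_zero fun i _ => Pi.single_eq_of_ne (hne i).symm _
      rcases Nat.eq_zero_or_pos m with rfl | hm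
      · exact hne 0 (Subsingleton.elim (α := Fin 1) _ _)
      · have h1 : j ≠ j + 1 := by
          obtain ⟨m, rfl⟩ : ∃ l, m = l + 1 := ⟨m - 1, by omega⟩
          simp
        have h2 := hj j
        simp only [h0, simplexStep, finRotate_apply, Pi.sub_apply, Pi.single_eq_same,
          Pi.single_eq_of_ne h1] at h2
        omega
    obtain ⟨i, hi⟩ := hpos
    obtain ⟨k, hk, hlt⟩ := lam.exists_row_eq_lt (by omega) (i.val + 1)
    obtain ⟨i', q, rfl⟩ := lam.exists_addable k hlt
    have hi' : lam.rowEnd p i'.1 = j := by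
      rw [← hi]
      refine (ZMod.intCast_eq_intCast_iff_dvd_sub _ _ (m + 1)).2 ⟨-q, ?_⟩
      rw [← hk, row_add_three_mul]
      ring
    refine ⟨i', Subtype.ext (funext fun j' => ?_)⟩
    have h1 := hj j'
    have h2 := toCycle_add p lam i' j'
    rw [hi'] at h2
    zify
    linarith

/-- All three rows end in column `0`; the shift `p` moves them to any prescribed corner. -/
theorem toCycle_zero (k : Fin (m + 1)) :
    (zero 3 (m + 1)).toCycle k.val = Simplex.corner (m + 1) 3 k := by
  refine Subtype.ext (funext fun j => ?_)
  have h : ∀ i, (zero 3 (m + 1)).rowEnd k.val i = k := by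
    intro i
    rw [rowEnd, zero_row _ _ _ (by omega) (by push_cast; omega), zero_add, Int.cast_natCast]
    exact ZMod.natCast_zmod_val (n := m + 1) k
  simp only [toCycle, h, Simplex.corner]
  simp [Pi.single_apply]

end Cycle

end CylindricShape

/-! ### Walks in the exclusion process -/

instance ExclusionState.subsingleton_hom {d L : ℕ} (u v : ExclusionState d L) :
    Subsingleton (u ⟶ v) :=
  inferInstanceAs (Subsingleton (PLift _))

namespace CylindricShape

variable {L : ℕ}

/-- The site of the particle that corresponds to the row `k`. -/
def site (lam : CylindricShape 3 L) (k : ℤ) : ℤ := k - lam.row k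

theorem site_strictMono (lam : CylindricShape 3 L) : StrictMono lam.site := by
  intro k k' h
  have := lam.antitone_row h.le
  unfold site
  omega

/-- The period `(3, L)` of the shape becomes the period `3 + L` of the sites, so the shape gives
three particles on the cycle. -/
theorem site_add_three_mul (lam : CylindricShape 3 L) (k q : ℤ) :
    lam.site (k + 3 * q) = lam.site k + ((3 + L : ℕ) : ℤ) * q := by
  rw [site, row_add_three_mul, site]
  push_cast
  ring

theorem cast_site_eq_iff (lam : CylindricShape 3 L) (k : ℤ) (z : ℤ) :
    ((lam.site k : ℤ) : ZMod (3 + L)) = (z : ZMod (3 + L)) ↔ ∃ q, lam.site (k + 3 * q) = z := by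
  rw [ZMod.intCast_eq_intCast_iff_dvd_sub]
  simp only [site_add_three_mul]
  exact exists_congr fun q => ⟨fun h => by linarith, fun h => by linarith⟩

theorem cast_site_eq_cast_site_iff (lam : CylindricShape 3 L) (k k' : ℤ) :
    ((lam.site k : ℤ) : ZMod (3 + L)) = (lam.site k' : ZMod (3 + L)) ↔ (3 : ℤ) ∣ k' - k := by
  rw [cast_site_eq_iff]
  exact exists_congr fun q => by rw [lam.site_strictMono.injective.eq_iff]; omega

open Classical in
/-- The state in which the sites of the rows are occupied. -/
noncomputable def toState (lam : CylindricShape 3 L) : ExclusionState 3 L :=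
  ⟨fun r => decide (∃ k, ((lam.site k : ℤ) : ZMod (3 + L)) = r), by
    have h : {r : ZMod (3 + L) | decide (∃ k, ((lam.site k : ℤ) : ZMod (3 + L)) = r) = true} =
        (fun i : Fin 3 => ((lam.site (i.val + 1) : ℤ) : ZMod (3 + L))) '' Set.univ := by
      ext r
      simp only [decide_eq_true_eq, Set.mem_ofPred_eq, Set.image_univ, Set.mem_range]
      constructor
      · rintro ⟨k, rfl⟩
        obtain ⟨i, q, rfl⟩ := exists_eq_row k
        exact ⟨i, (lam.cast_site_eq_cast_site_iff _ _).2 (by omega)⟩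
      · rintro ⟨i, h⟩
        exact ⟨_, h⟩
    rw [h, Set.ncard_image_of_injective, Set.ncard_univ, Nat.card_fin]
    intro i i' h
    have := (lam.cast_site_eq_cast_site_iff _ _).1 h
    exact Fin.ext (by omega)⟩

theorem toState_eq_true_iff (lam : CylindricShape 3 L) (r : ZMod (3 + L)) :
    lam.toState.1 r = true ↔ ∃ k, ((lam.site k : ℤ) : ZMod (3 + L)) = r := by
  simp [toState]

/-- The site of the particle that moves when the cell `i` is added. -/
def movingSite (lam : CylindricShape 3 L) (i : Addable lam) : ZMod (3 + L) :=
  (lam.site (i.1.val + 1) : ℤ)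

theorem toState_movingSite (lam : CylindricShape 3 L) (i : Addable lam) :
    lam.toState.1 (lam.movingSite i) = true :=
  (lam.toState_eq_true_iff _).2 ⟨_, rfl⟩

/-- A longer row above makes the sites of the two consecutive rows differ by at least `2`; by
monotonicity no other site lies between them. -/
theorem toState_movingSite_sub_one (lam : CylindricShape 3 L) (i : Addable lam) :
    lam.toState.1 (lam.movingSite i - 1) = false := by
  rw [← Bool.not_eq_true, toState_eq_true_iff]
  rintro ⟨k, hk⟩
  obtain ⟨q, hq⟩ := (lam.cast_site_eq_iff k (lam.site (i.1.val + 1) - 1)).1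
    (by rw [hk, movingSite, Int.cast_sub, Int.cast_one])
  have hi := i.2
  have h1 : lam.site i.1.val < lam.site (k + 3 * q) := by
    rw [hq]; unfold site; omega
  have h2 : lam.site (k + 3 * q) < lam.site (i.1.val + 1) := by omega
  have h1 := lam.site_strictMono.lt_iff_lt.1 h1
  have h2 := lam.site_strictMono.lt_iff_lt.1 h2
  omega

theorem toState_add (lam : CylindricShape 3 L) (i : Addable lam) (r : ZMod (3 + L)) :
    (lam.add i).toState.1 r = true ↔
      r = lam.movingSite i - 1 ∨ r ≠ lam.movingSite i ∧ lam.toState.1 r = true := by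
  have hs : ∀ k, (lam.add i).site k =
      if (3 : ℤ) ∣ k - (i.1.val + 1) then lam.site k - 1 else lam.site k := by
    intro k
    simp only [site, add_row]
    split_ifs <;> omega
  simp only [toState_eq_true_iff, hs, movingSite]
  constructor
  · rintro ⟨k, rfl⟩
    split_ifs with h
    · left
      rw [Int.cast_sub, Int.cast_one, (lam.cast_site_eq_cast_site_iff _ _).2 h]
    · right
      exact ⟨fun he => h ((lam.cast_site_eq_cast_site_iff _ _).1 he.symm), k, rfl⟩
  · rintro (rfl | ⟨hne, k, rfl⟩)
    · exact ⟨i.1.val + 1, by simp⟩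
    · refine ⟨k, ?_⟩
      rw [if_neg]
      exact fun h => hne ((lam.cast_site_eq_cast_site_iff _ _).2 h).symm

theorem card_walksFrom_toState (n : ℕ) (lam : CylindricShape 3 L) :
    Nat.card (WalksFrom n lam.toState) = growthCount n lam := by
  have : Fact (1 < 3 + L) := ⟨by omega⟩
  have hne : ∀ r : ZMod (3 + L), r ≠ r - 1 := fun r h => one_ne_zero (sub_eq_self.1 h.symm)
  refine card_walksFrom_eq_growthCount _ (fun lam i i' h => ?_) (fun lam i => ?_)
    (fun lam v e => ?_) n lam
  -- Otherwise the site left by the particle of `i` would still be occupied after the move of `i'`.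
  · have hr : lam.movingSite i = lam.movingSite i' := by
      by_contra hr
      have h1 := (lam.toState_add i' _).2 (.inr ⟨hr, lam.toState_movingSite i⟩)
      simp only at h
      rw [← h, toState_add] at h1
      rcases h1 with h1 | h1
      · exact hne _ h1
      · exact h1.1 rfl
    have := (lam.cast_site_eq_cast_site_iff _ _).1 hr
    exact Subtype.ext (Fin.ext (by omega))
  · refine ⟨⟨lam.movingSite i, lam.toState_movingSite_sub_one i, lam.toState_movingSite i,
      (lam.toState_add i _).2 (.inl rfl), ?_, fun t h1 h2 => ?_⟩⟩
    · rw [← Bool.not_eq_true, toState_add]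
      rintro (h | h)
      · exact hne _ h
      · exact h.1 rfl
    · rw [Bool.eq_iff_iff, toState_add]
      tauto
  · obtain ⟨r, h1, h2, h3, h4, h5⟩ := e.down
    obtain ⟨k, rfl⟩ := (lam.toState_eq_true_iff _).1 h2
    -- If rows `k - 1` and `k` were equal, the particle of row `k - 1` would block the jump.
    have hk : lam.row k < lam.row (k - 1) := by
      by_contra hk
      have := lam.antitone_row (show k - 1 ≤ k by omega)
      rw [← Bool.not_eq_true, toState_eq_true_iff] at h1
      refine h1 ⟨k - 1, ?_⟩
      rw [show lam.site (k - 1) = lam.site k - 1 by unfold site; omega, Int.cast_sub, Int.cast_one]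
    obtain ⟨i, q, rfl⟩ := lam.exists_addable k hk
    have hr : lam.movingSite i = (lam.site (i.1.val + 1 + 3 * q) : ℤ) :=
      (lam.cast_site_eq_cast_site_iff _ _).2 (by omega)
    rw [← hr] at h1 h2 h3 h4 h5
    refine ⟨i, Subtype.ext (funext fun t => ?_)⟩
    rw [Bool.eq_iff_iff, toState_add]
    by_cases ht : t = lam.movingSite i - 1
    · simp [ht, h3]
    by_cases ht' : t = lam.movingSite i
    · simp [ht', h4, hne]
    · simp [ht, ht', h5 t ht ht']

theorem toState_zero : (zero 3 L).toState = ExclusionState.packed 3 L := by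
  refine Subtype.ext (funext fun r => ?_)
  rw [Bool.eq_iff_iff, toState_eq_true_iff]
  have hs : ∀ k : ℤ, 1 ≤ k → k ≤ 3 → (zero 3 L).site k = k := fun k h1 h2 => by
    rw [site, zero_row 3 L k h1 h2, sub_zero]
  simp only [ExclusionState.packed, decide_eq_true_eq, Finset.mem_image, Finset.mem_Icc]
  constructor
  · rintro ⟨k, rfl⟩
    obtain ⟨i, q, rfl⟩ := exists_eq_row k
    refine ⟨i.val + 1, by omega, ?_⟩
    rw [(cast_site_eq_cast_site_iff _ _ (i.val + 1)).2 (by omega), hs _ (by omega) (by omega)]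
    push_cast
    rfl
  · rintro ⟨k, ⟨h1, h2⟩, rfl⟩
    exact ⟨k, by rw [hs k (by omega) (by omega)]; simp⟩

end CylindricShape

/-! ### Standard cylindric tableaux -/

/-- The numbering of the cells outside the inner shape by a standard cylindric tableau. -/
structure IsStandardNumbering {d L : ℕ} (n : ℕ) (lam mu : CylindricShape d L)
    (f : Cylinder d L → ℕ) : Prop where
  contained : mu.young ⊆ lam.young
  bijOn : Set.BijOn f (skewYoung lam mu) (Set.Icc 1 n)
  column_lt : ∀ i j : ℤ, Cylinder.cell d L i j ∈ skewYoung lam mu →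
    Cylinder.cell d L (i + 1) j ∈ skewYoung lam mu →
    f (Cylinder.cell d L i j) < f (Cylinder.cell d L (i + 1) j)
  row_lt : ∀ i j : ℤ, Cylinder.cell d L i j ∈ skewYoung lam mu →
    Cylinder.cell d L i (j + 1) ∈ skewYoung lam mu →
    f (Cylinder.cell d L i j) < f (Cylinder.cell d L i (j + 1))

namespace TableauxFrom

variable {d L n : ℕ} {mu : CylindricShape d L}

open Classical in
/-- The entry of a cell, or `0` if the cell does not belong to the tableau. -/
noncomputable def num (t : TableauxFrom n mu) (c : Cylinder d L) : ℕ :=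
  if h : c ∈ skewYoung t.1 mu then t.2.entry ⟨c, h⟩ else 0

theorem num_of_mem (t : TableauxFrom n mu) {c : Cylinder d L} (h : c ∈ skewYoung t.1 mu) :
    t.num c = t.2.entry ⟨c, h⟩ := dif_pos h

theorem isStandardNumbering_num (t : TableauxFrom n mu) : IsStandardNumbering n t.1 mu t.num where
  contained := t.2.contained
  bijOn := by
    refine ⟨fun c hc => ?_, fun c hc c' hc' h => ?_, fun k hk => ?_⟩
    · rw [num_of_mem t hc]
      exact (t.2.entry ⟨c, hc⟩).2
    · rw [num_of_mem t hc, num_of_mem t hc'] at h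
      exact congrArg Subtype.val (t.2.entry.injective (Subtype.ext h))
    · refine ⟨_, (t.2.entry.symm ⟨k, hk⟩).2, ?_⟩
      rw [num_of_mem t (t.2.entry.symm ⟨k, hk⟩).2]
      simp
  column_lt i j h h' := by
    rw [num_of_mem t h, num_of_mem t h']
    exact t.2.column_lt i j h h'
  row_lt i j h h' := by
    rw [num_of_mem t h, num_of_mem t h']
    exact t.2.row_lt i j h h'

/-- Numberings are functions on the whole cylinder, so entries can be compared without transporting
equivalences along equalities of shapes. -/
theorem ext_num {t t' : TableauxFrom n mu} (h : t.1 = t'.1)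
    (hnum : ∀ c ∈ skewYoung t.1 mu, t.num c = t'.num c) : t = t' := by
  obtain ⟨lam, T⟩ := t
  obtain ⟨lam', T'⟩ := t'
  obtain rfl : lam = lam' := h
  have : T.entry = T'.entry := Equiv.ext fun c => Subtype.ext (by
    have := hnum c.1 c.2
    rwa [num_of_mem ⟨lam, T⟩ c.2, num_of_mem ⟨lam, T'⟩ c.2] at this)
  cases T
  cases T'
  cases this
  rfl

/-- The tableau with a given numbering. -/
noncomputable def ofNumbering {lam : CylindricShape d L} {f : Cylinder d L → ℕ}
    (hf : IsStandardNumbering n lam mu f) : TableauxFrom n mu :=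
  ⟨lam, hf.contained, hf.bijOn.equiv f, fun i j h h' => hf.column_lt i j h h',
    fun i j h h' => hf.row_lt i j h h'⟩

theorem num_ofNumbering {lam : CylindricShape d L} {f : Cylinder d L → ℕ}
    (hf : IsStandardNumbering n lam mu f) {c : Cylinder d L} (hc : c ∈ skewYoung lam mu) :
    (ofNumbering hf).num c = f c :=
  num_of_mem (ofNumbering hf) hc

end TableauxFrom

theorem Cylinder.exists_eq_cell {d L : ℕ} (c : Cylinder d L) :
    ∃ i j : ℤ, c = Cylinder.cell d L i j := by
  obtain ⟨⟨i, j⟩, rfl⟩ := QuotientAddGroup.mk_surjective c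
  exact ⟨i, j, rfl⟩

namespace CylindricShape

theorem young_injective {d L : ℕ} :
    Function.Injective (young : CylindricShape d L → Set (Cylinder d L)) := by
  intro lam mu h
  refine CylindricShape.ext (funext fun i => le_antisymm ?_ ?_)
  · rw [← cell_mem_young, ← h, cell_mem_young]
  · rw [← cell_mem_young, h, cell_mem_young]

theorem cell_mem_skewYoung {d L : ℕ} (lam mu : CylindricShape d L) (i j : ℤ) :
    Cylinder.cell d L i j ∈ skewYoung lam mu ↔ j ≤ lam.row i ∧ mu.row i < j := by
  rw [skewYoung, Set.mem_sdiff, cell_mem_young, cell_mem_young, not_le]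

variable {L : ℕ}

/-- The cell that is added to the row `i + 1`. -/
def newCell (mu : CylindricShape 3 L) (i : Addable mu) : Cylinder 3 L :=
  Cylinder.cell 3 L (i.1.val + 1) (mu.row (i.1.val + 1) + 1)

theorem cell_eq_newCell_iff (mu : CylindricShape 3 L) (i : Addable mu) (a b : ℤ) :
    Cylinder.cell 3 L a b = mu.newCell i ↔ (3 : ℤ) ∣ a - (i.1.val + 1) ∧ b = mu.row a + 1 := by
  constructor
  · intro h
    -- The new cell separates the two diagrams; membership in them replaces a computation in the
    -- quotient.
    have h1 : mu.newCell i ∉ mu.young := by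
      rw [newCell, cell_mem_young]; omega
    have h2 : mu.newCell i ∈ (mu.add i).young := by
      rw [newCell, cell_mem_young, add_row, if_pos (by simp)]
    rw [← h, cell_mem_young] at h1 h2
    rw [add_row] at h2
    split_ifs at h2 with h3
    · exact ⟨h3, by omega⟩
    · omega
  · rintro ⟨⟨q, hq⟩, rfl⟩
    obtain rfl : a = i.1.val + 1 + 3 * q := by omega
    rw [row_add_three_mul]
    refine QuotientAddGroup.eq.2 (AddSubgroup.mem_zmultiples_iff.2 ⟨q, ?_⟩)
    refine Prod.ext ?_ ?_
    · simp; ring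
    · simp; ring

theorem mem_young_add_iff (mu : CylindricShape 3 L) (i : Addable mu) (c : Cylinder 3 L) :
    c ∈ (mu.add i).young ↔ c = mu.newCell i ∨ c ∈ mu.young := by
  obtain ⟨a, b, rfl⟩ := c.exists_eq_cell
  rw [cell_eq_newCell_iff, cell_mem_young, cell_mem_young, add_row]
  split_ifs with h <;> omega

theorem newCell_notMem_young (mu : CylindricShape 3 L) (i : Addable mu) :
    mu.newCell i ∉ mu.young := by
  rw [newCell, cell_mem_young]; omega

theorem mem_skewYoung_add_iff (lam mu : CylindricShape 3 L) (i : Addable mu) (c : Cylinder 3 L) :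
    c ∈ skewYoung lam (mu.add i) ↔ c ∈ skewYoung lam mu ∧ c ≠ mu.newCell i := by
  rw [skewYoung, skewYoung, Set.mem_sdiff, Set.mem_sdiff, mem_young_add_iff]
  tauto

open Classical in
/-- Adding a first cell to a numbering. -/
theorem isStandardNumbering_succ {n : ℕ} {lam mu : CylindricShape 3 L} (i : Addable mu)
    {f : Cylinder 3 L → ℕ} (hf : IsStandardNumbering n lam (mu.add i) f) :
    IsStandardNumbering (n + 1) lam mu fun c => if c = mu.newCell i then 1 else f c + 1 := by
  have hskew : ∀ c, c ∈ skewYoung lam mu → c ≠ mu.newCell i → c ∈ skewYoung lam (mu.add i) :=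
    fun c h h' => (mem_skewYoung_add_iff lam mu i c).2 ⟨h, h'⟩
  have hrange : ∀ c, c ∈ skewYoung lam mu → c ≠ mu.newCell i → 1 ≤ f c ∧ f c ≤ n :=
    fun c h h' => hf.bijOn.mapsTo (hskew c h h')
  have hnew : mu.newCell i ∈ skewYoung lam mu :=
    ⟨hf.contained ((mu.mem_young_add_iff i _).2 (.inl rfl)), mu.newCell_notMem_young i⟩
  refine ⟨fun c hc => hf.contained ((mu.mem_young_add_iff i c).2 (.inr hc)),
    ⟨fun c hc => ?_, fun c hc c' hc' h => ?_, fun k hk => ?_⟩, fun a b h h' => ?_, fun a b h h' => ?_⟩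
  · dsimp only
    split_ifs with h
    · exact ⟨le_rfl, by omega⟩
    · have := hrange c hc h
      exact ⟨by omega, by omega⟩
  · dsimp only at h
    split_ifs at h with h1 h2 h2
    · rw [h1, h2]
    · have := hrange c' hc' h2
      omega
    · have := hrange c hc h1
      omega
    · exact hf.bijOn.injOn (hskew c hc h1) (hskew c' hc' h2) (by omega)
  · obtain ⟨hk1, hk2⟩ := hk
    rcases hk1.eq_or_lt with rfl | hk1
    · exact ⟨mu.newCell i, hnew, if_pos rfl⟩
    · obtain ⟨c, hc, hck⟩ := hf.bijOn.surjOn (show k - 1 ∈ Set.Icc 1 n from ⟨by omega, by omega⟩)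
      obtain ⟨hc, hne⟩ := (mem_skewYoung_add_iff lam mu i c).1 hc
      refine ⟨c, hc, ?_⟩
      dsimp only
      rw [if_neg hne]
      omega
  · have h1 := (cell_mem_skewYoung _ _ _ _).1 h
    have h2 := (cell_mem_skewYoung _ _ _ _).1 h'
    have h3 := mu.antitone_row (show a ≤ a + 1 by omega)
    -- The cell above a new cell lies in `mu`, because the row above is longer.
    have hy : Cylinder.cell 3 L (a + 1) b ≠ mu.newCell i := by
      rw [Ne, cell_eq_newCell_iff]
      rintro ⟨⟨q, hq⟩, hb⟩
      have := i.lt_row q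
      rw [show (i.1.val : ℤ) + 1 + 3 * q = a + 1 by omega, add_sub_cancel_right] at this
      omega
    rw [if_neg hy]
    split_ifs with hx
    · have := hrange _ h' hy
      omega
    · exact Nat.succ_lt_succ (hf.column_lt a b (hskew _ h hx) (hskew _ h' hy))
  · have h1 := (cell_mem_skewYoung _ _ _ _).1 h
    have hy : Cylinder.cell 3 L a (b + 1) ≠ mu.newCell i := by
      rw [Ne, cell_eq_newCell_iff]
      omega
    rw [if_neg hy]
    split_ifs with hx
    · have := hrange _ h' hy
      omega
    · exact Nat.succ_lt_succ (hf.row_lt a b (hskew _ h hx) (hskew _ h' hy))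

/-- Removing the first cell of a numbering. -/
theorem isStandardNumbering_pred {n : ℕ} {lam mu : CylindricShape 3 L} (i : Addable mu)
    {f : Cylinder 3 L → ℕ} (hf : IsStandardNumbering (n + 1) lam mu f)
    (hi : mu.newCell i ∈ skewYoung lam mu) (hi1 : f (mu.newCell i) = 1) :
    IsStandardNumbering n lam (mu.add i) fun c => f c - 1 := by
  have hskew : ∀ c, c ∈ skewYoung lam (mu.add i) → c ∈ skewYoung lam mu :=
    fun c h => ((mem_skewYoung_add_iff lam mu i c).1 h).1
  -- The bound `2` makes the truncated subtraction `f c - 1` faithful.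
  have hrange : ∀ c, c ∈ skewYoung lam (mu.add i) → 2 ≤ f c ∧ f c ≤ n + 1 := by
    intro c h
    obtain ⟨h, hne⟩ := (mem_skewYoung_add_iff lam mu i c).1 h
    have h1 := hf.bijOn.mapsTo h
    have h2 : f c ≠ 1 := fun he => hne (hf.bijOn.injOn h hi (he.trans hi1.symm))
    have h3 := h1.1
    exact ⟨by omega, h1.2⟩
  refine ⟨fun c hc => ?_, ⟨fun c hc => ?_, fun c hc c' hc' h => ?_, fun k hk => ?_⟩,
    fun a b h h' => ?_, fun a b h h' => ?_⟩
  · rcases (mu.mem_young_add_iff i c).1 hc with rfl | hc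
    · exact hi.1
    · exact hf.contained hc
  · have := hrange c hc
    exact ⟨by dsimp only; omega, by dsimp only; omega⟩
  · have h1 := hrange c hc
    have h2 := hrange c' hc'
    exact hf.bijOn.injOn (hskew c hc) (hskew c' hc') (by dsimp only at h; omega)
  · obtain ⟨c, hc, hck⟩ := hf.bijOn.surjOn
      (show k + 1 ∈ Set.Icc 1 (n + 1) from ⟨by omega, Nat.succ_le_succ hk.2⟩)
    refine ⟨c, (mem_skewYoung_add_iff lam mu i c).2 ⟨hc, ?_⟩, by dsimp only; omega⟩
    rintro rfl
    have := hk.1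
    omega
  · have h1 := hrange _ h
    have h2 := hf.column_lt a b (hskew _ h) (hskew _ h')
    omega
  · have h1 := hrange _ h
    have h2 := hf.row_lt a b (hskew _ h) (hskew _ h')
    omega

/-- The cell with entry `1` has no left or upper neighbour in the skew diagram, as that would carry
a smaller entry; so it can be added to `mu`. -/
theorem exists_newCell {n : ℕ} {lam mu : CylindricShape 3 L} {f : Cylinder 3 L → ℕ}
    (hf : IsStandardNumbering (n + 1) lam mu f) :
    ∃ i : Addable mu, mu.newCell i ∈ skewYoung lam mu ∧ f (mu.newCell i) = 1 := by
  obtain ⟨c, hc, hc1⟩ := hf.bijOn.surjOn (show 1 ∈ Set.Icc 1 (n + 1) from ⟨le_rfl, by omega⟩)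
  obtain ⟨a, b, rfl⟩ := c.exists_eq_cell
  have h := (cell_mem_skewYoung _ _ _ _).1 hc
  have hrow : b = mu.row a + 1 := by
    by_contra hne
    have h1 : Cylinder.cell 3 L a (b - 1) ∈ skewYoung lam mu := by
      rw [cell_mem_skewYoung]; omega
    have h2 := hf.row_lt a (b - 1) h1 (by rwa [sub_add_cancel])
    have h3 := (hf.bijOn.mapsTo h1).1
    rw [sub_add_cancel] at h2
    omega
  have hlt : mu.row a < mu.row (a - 1) := by
    by_contra hle
    have h0 := lam.antitone_row (show a - 1 ≤ a by omega)
    have h1 : Cylinder.cell 3 L (a - 1) b ∈ skewYoung lam mu := by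
      rw [cell_mem_skewYoung]; omega
    have h2 := hf.column_lt (a - 1) b h1 (by rwa [sub_add_cancel])
    have h3 := (hf.bijOn.mapsTo h1).1
    rw [sub_add_cancel] at h2
    omega
  obtain ⟨i, q, rfl⟩ := mu.exists_addable a hlt
  rw [(mu.cell_eq_newCell_iff i _ b).2 ⟨by omega, hrow⟩] at hc hc1
  exact ⟨i, hc, hc1⟩

open Classical in
/-- The tableau obtained by adding a first cell. -/
noncomputable def consTableau {n : ℕ} {mu : CylindricShape 3 L}
    (t : Σ i : Addable mu, TableauxFrom n (mu.add i)) : TableauxFrom (n + 1) mu :=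
  TableauxFrom.ofNumbering (isStandardNumbering_succ t.1 t.2.isStandardNumbering_num)

theorem consTableau_bijective {n : ℕ} (mu : CylindricShape 3 L) :
    Function.Bijective (consTableau (n := n) (mu := mu)) := by
  classical
  have hmem : ∀ (i : Addable mu) (t : TableauxFrom n (mu.add i)),
      mu.newCell i ∈ skewYoung t.1 mu := fun i t =>
    ⟨t.2.contained ((mu.mem_young_add_iff i _).2 (.inl rfl)), mu.newCell_notMem_young i⟩
  have hnum : ∀ (i : Addable mu) (t : TableauxFrom n (mu.add i)) (c), c ∈ skewYoung t.1 mu →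
      (consTableau ⟨i, t⟩).num c = if c = mu.newCell i then 1 else t.num c + 1 :=
    fun i t c hc => TableauxFrom.num_ofNumbering _ hc
  constructor
  · rintro ⟨i, t⟩ ⟨i', t'⟩ h
    have hlam : t.1 = t'.1 := congrArg Sigma.fst h
    -- Both new cells carry the entry `1`, and every other entry is at least `2`.
    obtain rfl : i = i' := by
      have h1 := hnum i t _ (hmem i t)
      rw [if_pos rfl, h, hnum i' t' _ (hlam ▸ hmem i t)] at h1
      split_ifs at h1 with h2
      · rw [newCell, cell_eq_newCell_iff] at h2
        exact Subtype.ext (Fin.ext (by omega))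
      · have := (t'.isStandardNumbering_num.bijOn.mapsTo
          ((mem_skewYoung_add_iff _ mu i' _).2 ⟨hlam ▸ hmem i t, h2⟩)).1
        omega
    congr 1
    refine TableauxFrom.ext_num hlam fun c hc => ?_
    obtain ⟨hc, hne⟩ := (mem_skewYoung_add_iff _ mu i c).1 hc
    have h1 := hnum i t c hc
    rw [h, hnum i t' c (hlam ▸ hc), if_neg hne, if_neg hne] at h1
    omega
  · intro t
    obtain ⟨i, hi, hi1⟩ := exists_newCell t.isStandardNumbering_num
    have hpred := isStandardNumbering_pred i t.isStandardNumbering_num hi hi1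
    refine ⟨⟨i, TableauxFrom.ofNumbering hpred⟩, TableauxFrom.ext_num rfl fun c hc => ?_⟩
    have hc : c ∈ skewYoung t.1 mu := hc
    rw [hnum i _ c hc]
    split_ifs with h
    · rw [h, hi1]
    · rw [TableauxFrom.num_ofNumbering hpred ((mem_skewYoung_add_iff _ mu i c).2 ⟨hc, h⟩)]
      have := (t.isStandardNumbering_num.bijOn.mapsTo hc).1
      omega

theorem tableauxFrom_zero_nonempty_equiv (mu : CylindricShape 3 L) :
    Nonempty (TableauxFrom 0 mu ≃ Unit) := by
  have hempty : skewYoung mu mu = ∅ := Set.sdiff_self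
  have h : IsStandardNumbering 0 mu mu fun _ => 0 := by
    refine ⟨subset_rfl, ?_, fun i j h => ?_, fun i j h => ?_⟩
    · rw [hempty, Set.Icc_eq_empty (by norm_num)]
      exact Set.bijOn_empty _
    · rw [hempty] at h
      exact h.elim
    · rw [hempty] at h
      exact h.elim
  refine ⟨⟨fun _ => (), fun _ => TableauxFrom.ofNumbering h, fun t => ?_, fun _ => rfl⟩⟩
  refine TableauxFrom.ext_num (young_injective (t.2.contained.antisymm fun c hc => ?_)) fun c hc => ?_
  · by_contra hmu
    have := t.isStandardNumbering_num.bijOn.mapsTo ⟨hc, hmu⟩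
    exact absurd (this.1.trans this.2) (by norm_num)
  · exact absurd hc (by rw [TableauxFrom.ofNumbering, hempty]; exact Set.notMem_empty c)

theorem card_tableauxFrom (n : ℕ) (mu : CylindricShape 3 L) :
    Nat.card (TableauxFrom n mu) = growthCount n mu :=
  (finite_and_card_eq_growthCount (fun n mu => TableauxFrom n mu) id
    tableauxFrom_zero_nonempty_equiv
    (fun _ mu => ⟨(Equiv.ofBijective _ (consTableau_bijective mu)).symm⟩) n mu).2

end CylindricShape

/-! ### The counts in all the models -/

theorem mainTheorem11 (n L : ℕ) (hL : 1 ≤ L) :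
    Nat.card (TableauxFrom n (CylindricShape.zero 3 L)) = boundedMotzkin n L ∧
    (∀ k : Fin 3, Nat.card (WalksFrom n (Simplex.corner 3 L k)) = boundedMotzkin n L) ∧
    (∀ k : Fin L, Nat.card (WalksFrom n (Simplex.corner L 3 k)) = boundedMotzkin n L) ∧
    Nat.card (WalksFrom n (ExclusionState.packed 3 L)) = boundedMotzkin n L ∧
    Nat.card (WalksFrom n (ExclusionState.packed 3 L).necklace) = boundedMotzkin n L := by
  have hzero := CylindricShape.growthCount_of_corner n _ 0 (CylindricShape.gap_zero (L := L))
  rw [card_walksFrom_necklace, boundedMotzkin_eq_heightCount, ← CylindricShape.toState_zero,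
    CylindricShape.card_walksFrom_toState, CylindricShape.card_tableauxFrom]
  refine ⟨hzero, fun k => ?_, fun k => ?_, hzero, hzero⟩
  · rw [← CylindricShape.toTriangle_cornerShape, CylindricShape.card_walksFrom_toTriangle]
    exact CylindricShape.growthCount_of_corner n _ k (CylindricShape.gap_cornerShape k)
  · obtain ⟨m, rfl⟩ : ∃ m, L = m + 1 := ⟨L - 1, by omega⟩
    rw [← CylindricShape.toCycle_zero, CylindricShape.card_walksFrom_toCycle, hzero]
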